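/- All graphs are finite and may have parallel edges. Let $r$ be a positive odd integer. For a graph $G$ and $S\subseteq V(G)$ let $\partial(S)$ be the set of edges with precisely one end in $S$, and let $N_G(S)$ be the set of vertices outside $S$ that are adjacent to a vertex of $S$. An $r$-graph is an $r$-regular graph $G$ such that $|\partial(S)|\ge r$ for every $S\subseteq V(G)$ of odd cardinality. If $G$ is an $r$-graph and $S\subseteq V(G)$ has even cardinality and $|\partial(S)|=2$, then $N_G(S)$ consists of precisely two vertices $u,v$. The graph obtained from $G$ by deleting $S$ together with all edges incident with it and adding a new edge $uv$ is said to be obtained from $G$ by a $2$-cut reduction. An automorphism of a graph $G$ is a permutation $\alpha$ of $V(G)$ such that, for all vertices $x,y$, the number of edges between $\alpha(x)$ and $\alpha(y)$ equals the number of edges between $x$ and $y$. For $i\ge 1$ let $T_i^r$ be the tree with all vertex degrees in $\{1,r\}$ that has a vertex of degree $r$, the root, at distance $i$ from every leaf other than the root itself (for $r=1$ the only such tree is $K_2$, with $i=1$ and either vertex as root). A rotation $r$-graph is an $r$-graph $G$ that, for some $i$, has a spanning tree $T$ isomorphic to $T_i^r$ and an automorphism $\alpha$ of $G$ which is also an automorphism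 of $T$, fixes the root of $T$, and satisfies, for every other vertex $x$, that the smallest positive integer $k$ with $\alpha^k(x)=x$ is $r$. A graph is simple if it has neither loops nor parallel edges. Let $A$ be a graph property (invariant under isomorphism) that is preserved under $2$-cut reduction, i.e. whenever a connected $r$-graph $G$ has property $A$ and $G'$ is obtained from $G$ by a $2$-cut reduction, then $G'$ has property $A$. Then every connected (non-empty) $r$-graph has property $A$ if and only if every simple rotation $r$-graph has property $A$. -/

import Mathlib

universe u v

namespace Graph

variable {α : Type u} {β : Type v}

/-- The number of edges between `x` and `y`. -/
noncomputable def edgeCount (G : Graph α β) (x y : α) : ℕ := {e | G.IsLink e x y}.ncard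

/-- The degree of a vertex; a loop contributes two. -/
noncomputable def deg (G : Graph α β) (x : α) : ℕ :=
  (G.incidenceSet x).ncard + (G.loopSet x).ncard

/-- `∂(S)`: the edges with precisely one end in `S`. -/
def edgeBoundary (G : Graph α β) (S : Set α) : Set β :=
  {e | ∃ x y, G.IsLink e x y ∧ x ∈ S ∧ y ∉ S}

/-- `N_G(S)`: the vertices outside `S` that are adjacent to a vertex of `S`. -/
def neighbors (G : Graph α β) (S : Set α) : Set α :=
  {u | u ∈ V(G) \ S ∧ ∃ x ∈ S, G.Adj u x}

/-- A multigraph is connected if it has a vertex and any two vertices are joined by a path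
(loops and parallel edges do not matter for this). -/
def IsConnected (G : Graph α β) : Prop := G.toSimpleGraph.Connected

/-- A multigraph is a tree if it has no loops and no parallel edges and is a tree as a
simple graph. -/
def IsTree (T : Graph α β) : Prop := T.Simple ∧ T.toSimpleGraph.IsTree

/-- Isomorphism of multigraphs, possibly on different vertex and edge types. -/
def Isomorphic {α' : Type*} {β' : Type*} (G : Graph α β) (H : Graph α' β') : Prop :=
  ∃ (f : V(G) ≃ V(H)) (g : E(G) ≃ E(H)), ∀ (e : E(G)) (x y : V(G)),
    G.IsLink e x y ↔ H.IsLink (g e) (f x) (f y)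

/-- `φ` restricts to an automorphism of `G`: a permutation of the vertices that
preserves the number of edges between any two vertices. -/
def IsAutomorphism (G : Graph α β) (φ : α → α) : Prop :=
  Set.BijOn φ V(G) V(G) ∧
    ∀ x ∈ V(G), ∀ y ∈ V(G), G.edgeCount (φ x) (φ y) = G.edgeCount x y

/-- An `r`-graph: a finite `r`-regular multigraph with `|∂(S)| ≥ r` for every set `S` of vertices
of odd cardinality. (Loops are then impossible, because `|∂({x})| ≥ r`.) -/
structure IsRGraph (G : Graph α β) (r : ℕ) : Prop where
  finite_vertexSet : V(G).Finite
  finite_edgeSet : E(G).Finite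
  deg_eq : ∀ x ∈ V(G), G.deg x = r
  le_boundary : ∀ S ⊆ V(G), Odd S.ncard → r ≤ (G.edgeBoundary S).ncard

/-- `T` is (a copy of) the tree `T_i^r` with root `v`: all degrees lie in `{1, r}` and every leaf
has distance `i` to `v`. The root is required to have degree `r` and is itself not counted as
a leaf. For `r ≥ 2` both provisions are automatic (a finite tree with at least two vertices
has at least two leaves); they matter for `r = 1` only, where the tree is `K₂` and `i = 1`. -/
structure IsRootedT (T : Graph α β) (r i : ℕ) (v : V(T)) : Prop where
  isTree : T.IsTree
  deg_mem : ∀ x : V(T), T.deg x = 1 ∨ T.deg x = r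
  deg_root : T.deg v = r
  dist_leaf : ∀ x : V(T), x ≠ v → T.deg x = 1 → T.toSimpleGraph.dist v x = i

/-- `φ` is an automorphism of the tree `T` that is rotational with respect to `v`: it fixes `v`,
and for every other vertex `x` the smallest positive `k` with `φ^k x = x` is the degree of `v`. -/
structure IsRotational (T : Graph α β) (v : α) (φ : α → α) : Prop where
  isAutomorphism : T.IsAutomorphism φ
  period_root : Function.minimalPeriod φ v = 1
  period_eq : ∀ x ∈ V(T), x ≠ v → Function.minimalPeriod φ x = T.deg v

/-- A rotation `r`-graph: an `r`-graph with a spanning tree `T` isomorphic to `T_i^r` for some `i`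
and an automorphism that is rotational on `T` with respect to the root. -/
def IsRotationRGraph (G : Graph α β) (r : ℕ) : Prop :=
  G.IsRGraph r ∧ ∃ (i : ℕ) (T : Graph α β) (v : V(T)) (φ : α → α),
    T ≤s G ∧ T.IsRootedT r i v ∧ G.IsAutomorphism φ ∧ T.IsRotational v φ

/-- `G'` is obtained from `G` by a 2-cut reduction of `S`: `S` is a set of vertices of even
cardinality with `|∂(S)| = 2` and `N_G(S) = {u, v}`, and `G'` arises from `G` by deleting `S`
(with all edges incident with it) and adding a new edge `e` between `u` and `v`. -/
def IsTwoCutReduction (G : Graph α β) (S : Set α) (G' : Graph α β) : Prop :=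
  S ⊆ V(G) ∧ Even S.ncard ∧ (G.edgeBoundary S).ncard = 2 ∧
    ∃ u v : α, u ≠ v ∧ G.neighbors S = {u, v} ∧
      ∃ e : β, e ∉ E(G.deleteVerts S) ∧ V(G') = V(G) \ S ∧
        ∀ f x y, G'.IsLink f x y ↔
          ((G.deleteVerts S).IsLink f x y ∨ (f = e ∧ s(x, y) = s(u, v)))

/-- A graph property: a predicate on multigraphs that is invariant under isomorphism. -/
def IsGraphProperty (A : ∀ (α : Type u) (β : Type v), Graph α β → Prop) : Prop :=
  ∀ (α α' : Type u) (β β' : Type v) (G : Graph α β) (H : Graph α' β'),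
    G.Isomorphic H → A α β G → A α' β' H

/-- `A` passes from every connected `r`-graph to each of its 2-cut reductions. -/
def PreservedByTwoCutReduction (A : ∀ (α : Type u) (β : Type v), Graph α β → Prop)
    (r : ℕ) : Prop :=
  ∀ (α : Type u) (β : Type v) (G G' : Graph α β) (S : Set α),
    G.IsRGraph r → G.IsConnected → G.IsTwoCutReduction S G' → A α β G → A α β G'

end Graph

/-! ### Parity of edge cuts, looplessness, connectivity through cuts. -/

namespace Graph

variable {α : Type u} {β : Type v} {G : Graph α β} {S X Y : Set α} {e : β} {x y : α} {r : ℕ}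

/-! A rotation `r`-graph has a spanning tree, so it is connected; this gives one direction. For the
other, every connected `r`-graph `G` with `r > 1` arises, up to isomorphism, by successive 2-cut
reductions from a connected simple rotation `r`-graph, and the property descends along these
reductions. The case `r = 1` is `K₂`.

Construction (`rotGraph`): fix a base edge of `G`, measure levels from its two ends, and let every
vertex of positive level choose an edge to the previous level (`Layered`). A root is joined to `r`
rim vertices indexed by `ZMod r`. Between the rim vertices `j` and `j + 1` lie `r / 2` copies of `G`
without its base edge, whose two ends are joined to these rim vertices instead. In each copy every
free edge (neither base nor chosen) is replaced by a pair of trees with branching `r - 1`, one at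
each end, grown until all leaves have depth `D + 4`. The leaves are then joined by graphs
`K_{r-1,r-1}` if the two ends have equal level. If the levels differ by one, they are joined by
cliques `K_r`, each made of one leaf of the shorter tree and `r - 1` leaves of the other. All edges
except these last ones form the spanning tree, and `j ↦ j + 1` is the rotation.

Odd cuts (`rotGraph_isRGraph`): tree pairs and copies are attached by just two edges, so uncrossing
(`le_ncard_edgeBoundary_of_saturated`) leaves three kinds of odd sets. Inside a tree pair, an edge
colouring showing each of `r` colours once at every vertex forces all colours into the boundary.
Inside a copy, a set crossing no tree pair inherits the bound from `G`. A set crossing no copy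
amounts to a set of vertices of a wheel, whose cuts are counted directly.

Recovery (`of_rotGraph`): for one fixed copy, reducing each tree pair restores the free edge that it
replaced, and reducing the complement of the copy restores the base edge. -/

lemma edgeBoundary_subset : G.edgeBoundary X ⊆ E(G) := by
  rintro e ⟨x, y, h, -⟩
  exact h.edge_mem

lemma IsLink.mem_edgeBoundary_iff (h : G.IsLink e x y) :
    e ∈ G.edgeBoundary X ↔ (x ∈ X ∧ y ∉ X) ∨ (y ∈ X ∧ x ∉ X) := by
  constructor
  · rintro ⟨a, b, hab, ha, hb⟩
    obtain ⟨rfl, rfl⟩ | ⟨rfl, rfl⟩ := h.eq_and_eq_or_eq_and_eq hab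
    · exact .inl ⟨ha, hb⟩
    · exact .inr ⟨ha, hb⟩
  · rintro (⟨ha, hb⟩ | ⟨ha, hb⟩)
    · exact ⟨x, y, h, ha, hb⟩
    · exact ⟨y, x, h.symm, ha, hb⟩

/-- An edge lies in a boundary when exactly one of its ends lies in the set, and this condition is
additive modulo two in the set. -/
lemma edgeBoundary_symmDiff (G : Graph α β) (X Y : Set α) :
    G.edgeBoundary (symmDiff X Y) = symmDiff (G.edgeBoundary X) (G.edgeBoundary Y) := by
  ext e
  by_cases he : e ∈ E(G)
  · obtain ⟨x, y, h⟩ := G.exists_isLink_of_mem_edgeSet he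
    rw [Set.mem_symmDiff, h.mem_edgeBoundary_iff, h.mem_edgeBoundary_iff, h.mem_edgeBoundary_iff,
      Set.mem_symmDiff, Set.mem_symmDiff]
    tauto
  · have h1 : ∀ Z, e ∉ G.edgeBoundary Z := fun Z h ↦ he (edgeBoundary_subset h)
    simp [Set.mem_symmDiff, h1]

lemma edgeBoundary_union (h : Disjoint X Y) :
    G.edgeBoundary (X ∪ Y) = symmDiff (G.edgeBoundary X) (G.edgeBoundary Y) := by
  rw [← edgeBoundary_symmDiff, h.symmDiff_eq_sup]; rfl

lemma ncard_symmDiff_add {A B : Set β} (hA : A.Finite) (hB : B.Finite) :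
    (symmDiff A B).ncard + 2 * (A ∩ B).ncard = A.ncard + B.ncard := by
  have h1 : (symmDiff A B).ncard = (A \ B).ncard + (B \ A).ncard := by
    rw [Set.symmDiff_def]
    exact Set.ncard_union_eq (disjoint_sdiff_sdiff) hA.sdiff hB.sdiff
  have h2 := Set.ncard_inter_add_ncard_sdiff_eq_ncard A B hA
  have h3 := Set.ncard_inter_add_ncard_sdiff_eq_ncard B A hB
  rw [Set.inter_comm B A] at h3
  omega

lemma ncard_edgeBoundary_union (hE : E(G).Finite) (h : Disjoint X Y) :
    (G.edgeBoundary (X ∪ Y)).ncard + 2 * (G.edgeBoundary X ∩ G.edgeBoundary Y).ncard =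
      (G.edgeBoundary X).ncard + (G.edgeBoundary Y).ncard := by
  rw [edgeBoundary_union h]
  exact ncard_symmDiff_add (hE.subset edgeBoundary_subset) (hE.subset edgeBoundary_subset)

lemma edgeBoundary_empty : G.edgeBoundary ∅ = ∅ := by
  ext e; simp [edgeBoundary]

/-- If a set `M` of edges meets the boundary of every vertex of `X` in an odd number of edges,
then it meets the boundary of `X` in `|X|` edges modulo two. -/
lemma odd_ncard_edgeBoundary_inter (hE : E(G).Finite) (M : Set β) (hX : X.Finite)
    (h : ∀ x ∈ X, Odd (G.edgeBoundary {x} ∩ M).ncard) :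
    Odd (G.edgeBoundary X ∩ M).ncard ↔ Odd X.ncard := by
  induction X, hX using Set.Finite.induction_on with
  | empty => simp [edgeBoundary_empty]
  | @insert x X hx hX ih =>
    have hd : Disjoint {x} X := Set.disjoint_singleton_left.2 hx
    have ih := ih fun y hy ↦ h y (Set.mem_insert_of_mem _ hy)
    have h1 := h x (Set.mem_insert _ _)
    have hf : ∀ Z, (G.edgeBoundary Z ∩ M).Finite := fun Z ↦
      (hE.subset edgeBoundary_subset).subset Set.inter_subset_left
    have h2 := ncard_symmDiff_add (hf {x}) (hf X)
    have h3 : symmDiff (G.edgeBoundary {x} ∩ M) (G.edgeBoundary X ∩ M) =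
        G.edgeBoundary (insert x X) ∩ M := by
      rw [Set.insert_eq, edgeBoundary_union hd]
      ext e
      simp only [Set.mem_symmDiff, Set.mem_inter_iff]
      tauto
    rw [h3] at h2
    rw [Set.ncard_insert_of_notMem hx hX]
    -- The intersection is counted twice in `h2`, so parities add.
    grind

/-- The case where `M` is everything. For odd `r` it shows that a set with a boundary of two edges
has even size. -/
lemma odd_ncard_edgeBoundary (hE : E(G).Finite) (hX : X.Finite)
    (h : ∀ x ∈ X, Odd (G.edgeBoundary {x}).ncard) :
    Odd (G.edgeBoundary X).ncard ↔ Odd X.ncard := by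
  simpa using odd_ncard_edgeBoundary_inter hE Set.univ hX (by simpa using h)

lemma incidenceSet_eq_union (G : Graph α β) (x : α) :
    G.incidenceSet x = G.edgeBoundary {x} ∪ G.loopSet x := by
  ext e
  constructor
  · rintro ⟨y, h⟩
    by_cases hxy : y = x
    · subst hxy; exact .inr h
    · exact .inl ⟨x, y, h, rfl, hxy⟩
  · rintro (⟨a, b, h, rfl, -⟩ | h)
    · exact ⟨b, h⟩
    · exact ⟨x, h⟩

lemma disjoint_edgeBoundary_loopSet (G : Graph α β) (x : α) :
    Disjoint (G.edgeBoundary {x}) (G.loopSet x) := by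
  rw [Set.disjoint_left]
  intro e he hl
  have := (IsLink.mem_edgeBoundary_iff (G := G) (x := x) (y := x) (X := {x}) hl).1 he
  tauto

lemma deg_eq_ncard_edgeBoundary [G.Loopless] (x : α) :
    G.deg x = (G.edgeBoundary {x}).ncard := by
  have h : G.loopSet x = ∅ := by ext e; simp
  rw [deg, incidenceSet_eq_union, h, Set.union_empty, Set.ncard_empty, add_zero]

/-- The odd-cut condition at `{x}` already provides `r` edges leaving `x`, which leaves no degree
for a loop. -/
lemma IsRGraph.loopless (hG : G.IsRGraph r) : G.Loopless := by
  refine ⟨fun e x hl ↦ ?_⟩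
  have hx : x ∈ V(G) := hl.vertex_mem
  have h1 := hG.deg_eq x hx
  have h2 := hG.le_boundary {x} (by simpa using hx) (by simp)
  have hfin : ∀ A ⊆ E(G), A.Finite := fun A hA ↦ hG.finite_edgeSet.subset hA
  have hls : G.loopSet x ⊆ E(G) := fun e he ↦ IsLoopAt.edge_mem he
  rw [deg, incidenceSet_eq_union, Set.ncard_union_eq (disjoint_edgeBoundary_loopSet G x)
    (hfin _ edgeBoundary_subset) (hfin _ hls)] at h1
  have h3 : 0 < (G.loopSet x).ncard := (Set.ncard_pos (hfin _ hls)).2 ⟨e, hl⟩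
  omega

lemma IsRGraph.ncard_edgeBoundary_singleton (hG : G.IsRGraph r) (hx : x ∈ V(G)) :
    (G.edgeBoundary {x}).ncard = r := by
  have := hG.loopless
  rw [← deg_eq_ncard_edgeBoundary, hG.deg_eq x hx]

lemma isRGraph_of_edgeBoundary [G.Loopless] (hV : V(G).Finite) (hE : E(G).Finite)
    (hdeg : ∀ x ∈ V(G), (G.edgeBoundary {x}).ncard = r)
    (hodd : ∀ X ⊆ V(G), Odd X.ncard → r ≤ (G.edgeBoundary X).ncard) : G.IsRGraph r :=
  ⟨hV, hE, fun x hx ↦ by rw [deg_eq_ncard_edgeBoundary, hdeg x hx], hodd⟩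

/-- A multigraph is connected if and only if it has a vertex and no empty cut. -/
lemma isConnected_iff_edgeBoundary :
    G.IsConnected ↔ V(G).Nonempty ∧
      ∀ X ⊆ V(G), X.Nonempty → X ≠ V(G) → (G.edgeBoundary X).Nonempty := by
  constructor
  · intro h
    have hne := h.nonempty
    refine ⟨Set.nonempty_coe_sort.1 hne, fun X hX ⟨a, ha⟩ hXV ↦ ?_⟩
    obtain ⟨b, hb, hbX⟩ := Set.exists_of_ssubset (hX.ssubset_of_ne hXV)
    obtain ⟨w⟩ := h.preconnected ⟨a, hX ha⟩ ⟨b, hb⟩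
    obtain ⟨d, -, hd1, hd2⟩ := w.exists_boundary_dart {z | (z : α) ∈ X} ha hbX
    obtain ⟨-, e, he⟩ := d.adj
    exact ⟨e, _, _, he, hd1, hd2⟩
  · rintro ⟨⟨a, ha⟩, h⟩
    have key : ∀ b : V(G), G.toSimpleGraph.Reachable ⟨a, ha⟩ b := by
      by_contra! hcon
      obtain ⟨b, hb⟩ := hcon
      -- The set of vertices reachable from `a` would have an edge leaving it, whose outer end is
      -- then reachable too.
      obtain ⟨e, x, y, hl, ⟨z, hz, rfl⟩, hy⟩ := h
        ((↑) '' {z : V(G) | G.toSimpleGraph.Reachable ⟨a, ha⟩ z}) (by simp)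
        ⟨a, ⟨a, ha⟩, SimpleGraph.Reachable.refl _, rfl⟩
        (fun heq ↦ by
          obtain ⟨z, hz, hzb⟩ := heq.ge b.2
          rw [Subtype.ext hzb] at hz
          exact hb hz)
      refine hy ⟨⟨y, hl.right_mem⟩, ?_, rfl⟩
      have hz' : G.toSimpleGraph.Reachable ⟨a, ha⟩ z := hz
      by_cases hzy : z = ⟨y, hl.right_mem⟩
      · rw [hzy] at hz'; exact hz'
      · refine hz'.trans (SimpleGraph.Adj.reachable ?_)
        exact ⟨hzy, e, hl⟩
    have : Nonempty V(G) := ⟨⟨a, ha⟩⟩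
    exact ⟨fun b c ↦ (key b).symm.trans (key c)⟩

/-- Cuts live in `α`, so the subtypes `V(T)` and `V(G)` need not be identified. -/
lemma IsConnected.mono {T : Graph α β} (hT : T.IsConnected) (h : T ≤s G) : G.IsConnected := by
  rw [isConnected_iff_edgeBoundary] at hT ⊢
  rw [h.vertexSet_eq] at hT
  refine ⟨hT.1, fun X hX h1 h2 ↦ (hT.2 X hX h1 h2).mono ?_⟩
  rintro e ⟨x, y, hl, hx, hy⟩
  exact ⟨x, y, hl.mono h.le, hx, hy⟩

end Graph

/-! ### Uncrossing along two-edge cuts, and 2-cut reductions. -/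

namespace Graph

variable {α : Type u} {β : Type v} {G : Graph α β} {S X Y : Set α} {e : β} {x y : α} {r : ℕ}

/-- Uncrossing an odd set with a set of boundary two. -/
lemma uncross_of_ncard_edgeBoundary_eq_two (hV : V(G).Finite) (hE : E(G).Finite)
    (hdeg : ∀ x ∈ V(G), Odd (G.edgeBoundary {x}).ncard) (hSV : S ⊆ V(G))
    (hS : (G.edgeBoundary S).ncard = 2)
    (hSr : ∀ Y ⊆ S, Odd Y.ncard → r ≤ (G.edgeBoundary Y).ncard)
    (hXV : X ⊆ V(G)) (hX : Odd X.ncard) :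
    r ≤ (G.edgeBoundary X).ncard ∨
      (Odd (X \ S).ncard ∧ (G.edgeBoundary (X \ S)).ncard ≤ (G.edgeBoundary X).ncard) ∨
      (Odd (X ∪ S).ncard ∧ (G.edgeBoundary (X ∪ S)).ncard ≤ (G.edgeBoundary X).ncard) := by
  have hpar : ∀ Y ⊆ V(G), (Odd (G.edgeBoundary Y).ncard ↔ Odd Y.ncard) := fun Y hY ↦
    odd_ncard_edgeBoundary hE (hV.subset hY) fun x hx ↦ hdeg x (hY hx)
  have hfin : ∀ Y, (G.edgeBoundary Y).Finite := fun Y ↦ hE.subset edgeBoundary_subset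
  have hXf := hV.subset hXV
  have hSf := hV.subset hSV
  have hPQ : Disjoint (X ∩ S) (X \ S) := disjoint_inf_sdiff
  have hQS : Disjoint (X \ S) S := disjoint_sdiff_self_left
  have hcX := Set.ncard_inter_add_ncard_sdiff_eq_ncard X S hXf
  have hbX := ncard_edgeBoundary_union hE hPQ
  rw [Set.inter_union_sdiff] at hbX
  have hbXS := ncard_edgeBoundary_union hE hQS
  have hcXS := Set.ncard_union_eq hQS hXf.sdiff hSf
  rw [Set.sdiff_union_self] at hbXS hcXS
  have hSe : ¬ Odd S.ncard := by rw [← hpar S hSV, hS]; decide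
  have hPo := hpar (X ∩ S) (Set.inter_subset_left.trans hXV)
  have hQo := hpar (X \ S) (Set.sdiff_subset.trans hXV)
  -- An edge in both boundaries joins `X ∩ S` to `X \ S`, hence leaves `S`; there are at most two
  -- such edges.
  have hkS : G.edgeBoundary (X ∩ S) ∩ G.edgeBoundary (X \ S) ⊆ G.edgeBoundary S := by
    rintro e ⟨h1, h2⟩
    obtain ⟨a, b, hl, ha, hb⟩ := h1
    rw [hl.mem_edgeBoundary_iff] at h2
    rw [hl.mem_edgeBoundary_iff]
    simp only [Set.mem_inter_iff, Set.mem_sdiff] at *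
    tauto
  have hk2 := Set.ncard_le_ncard hkS (hfin _)
  have hkQ : (G.edgeBoundary (X ∩ S) ∩ G.edgeBoundary (X \ S)).ncard ≤ _ :=
    Set.ncard_inter_le_ncard_right _ _ (hfin _)
  have hkP : (G.edgeBoundary (X ∩ S) ∩ G.edgeBoundary (X \ S)).ncard ≤ _ :=
    Set.ncard_inter_le_ncard_left _ _ (hfin _)
  have hkl : (G.edgeBoundary (X ∩ S) ∩ G.edgeBoundary (X \ S)).ncard ≤
      (G.edgeBoundary (X \ S) ∩ G.edgeBoundary S).ncard :=
    Set.ncard_le_ncard (fun e he ↦ ⟨he.2, hkS he⟩) ((hfin _).inter_of_left _)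
  -- Let `k ≤ 2` be the number of edges between `X ∩ S` and `X \ S`, so `|∂X| = |∂(X ∩ S)| + |∂(X \
  -- S)| - 2k`. If `X ∩ S` is odd, then `|∂(X \ S)|` is even and at least `k`, which settles `k ≤
  -- 1`.
  by_cases hP : Odd (X ∩ S).ncard
  · left
    have h1 := hSr _ Set.inter_subset_right hP
    -- If `k = 2`, both edges of `∂S` leave `X ∩ S`, so the odd set `S \ X` has boundary `|∂(X ∩ S)|
    -- - 2`, which must be at least `r`.
    have hk : (G.edgeBoundary (X ∩ S) ∩ G.edgeBoundary (X \ S)).ncard = 2 →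
        r + 2 ≤ (G.edgeBoundary (X ∩ S)).ncard := by
      intro hk
      have h2 := Set.eq_of_subset_of_ncard_le hkS (by omega) (hfin _)
      have h3 := ncard_symmDiff_add (hfin S) (hfin (X ∩ S))
      have h6 : G.edgeBoundary S ∩ G.edgeBoundary (X ∩ S) = G.edgeBoundary S :=
        Set.inter_eq_left.2 (h2 ▸ Set.inter_subset_left)
      have h7 : X ∩ S ≤ S := Set.inter_subset_right
      rw [← edgeBoundary_symmDiff, symmDiff_of_ge h7, h6] at h3
      have h4 := Set.ncard_sdiff_add_ncard_of_subset (Set.inter_subset_right (s := X) (t := S)) hSf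
      have h5 := hSr (S \ (X ∩ S)) Set.sdiff_subset (by grind)
      omega
    grind
  · right
    -- Now `X \ S` is odd. Unless `∂(X ∩ S)` is empty, it has at least two edges by parity, and
    -- replacing `X ∩ S` by all of `S` does not enlarge the boundary.
    by_cases h0 : (G.edgeBoundary (X ∩ S)).ncard = 0
    · left; exact ⟨by grind, by omega⟩
    · right; exact ⟨by grind, by grind⟩

/-- To verify the odd-cut condition it suffices, given disjoint sets of boundary two
whose odd subsets satisfy the condition, to consider the odd sets not crossing any of them. -/
lemma le_ncard_edgeBoundary_of_saturated {ι : Type*} (hV : V(G).Finite) (hE : E(G).Finite)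
    (hdeg : ∀ x ∈ V(G), Odd (G.edgeBoundary {x}).ncard) {W : Set α} (hW : W ⊆ V(G))
    (F : Finset ι) (S : ι → Set α) (hSW : ∀ i ∈ F, S i ⊆ W)
    (hS : ∀ i ∈ F, (G.edgeBoundary (S i)).ncard = 2)
    (hSr : ∀ i ∈ F, ∀ Y ⊆ S i, Odd Y.ncard → r ≤ (G.edgeBoundary Y).ncard)
    (hdisj : ∀ i ∈ F, ∀ j ∈ F, i ≠ j → Disjoint (S i) (S j))
    (hsat : ∀ X ⊆ W, Odd X.ncard → (∀ i ∈ F, Disjoint X (S i) ∨ S i ⊆ X) →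
      r ≤ (G.edgeBoundary X).ncard) :
    ∀ X ⊆ W, Odd X.ncard → r ≤ (G.edgeBoundary X).ncard := by
  classical
  induction F using Finset.induction_on with
  | empty => exact fun X hX ho ↦ hsat X hX ho (by simp)
  | @insert i F hi ih =>
    -- A set `X` saturated for `F` is uncrossed with `S i`. Both `X \ S i` and `X ∪ S i` stay
    -- saturated for `F` by disjointness, and stay inside `W`.
    refine ih (fun j hj ↦ hSW j (Finset.mem_insert_of_mem hj))
      (fun j hj ↦ hS j (Finset.mem_insert_of_mem hj))
      (fun j hj ↦ hSr j (Finset.mem_insert_of_mem hj))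
      (fun j hj k hk ↦ hdisj j (Finset.mem_insert_of_mem hj) k (Finset.mem_insert_of_mem hk)) ?_
    intro X hX ho hs
    have hmem := Finset.mem_insert_self i F
    have hd : ∀ j ∈ F, Disjoint (S j) (S i) := fun j hj ↦
      hdisj j (Finset.mem_insert_of_mem hj) i hmem (fun h ↦ hi (h ▸ hj))
    obtain h | ⟨h1, h2⟩ | ⟨h1, h2⟩ := uncross_of_ncard_edgeBoundary_eq_two hV hE hdeg
      ((hSW i hmem).trans hW) (hS i hmem) (hSr i hmem) (hX.trans hW) ho
    · exact h
    · refine (hsat _ (Set.sdiff_subset.trans hX) h1 fun j hj ↦ ?_).trans h2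
      obtain rfl | hj := Finset.mem_insert.1 hj
      · exact .inl disjoint_sdiff_self_left
      · obtain h | h := hs j hj
        · exact .inl (h.mono_left Set.sdiff_subset)
        · exact .inr (Set.subset_sdiff.2 ⟨h, hd j hj⟩)
    · refine (hsat _ (Set.union_subset hX (hSW i hmem)) h1 fun j hj ↦ ?_).trans h2
      obtain rfl | hj := Finset.mem_insert.1 hj
      · exact .inr Set.subset_union_right
      · obtain h | h := hs j hj
        · exact .inl (Set.disjoint_union_left.2 ⟨h, (hd j hj).symm⟩)
        · exact .inr (h.trans Set.subset_union_left)

/-- `S` is a set of vertices whose boundary consists of the edges `c` and `c'`, which lead to the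
distinct vertices `a` and `b` outside `S`. -/
structure IsTwoCut (G : Graph α β) (S : Set α) (c c' : β) (a b : α) : Prop where
  subset : S ⊆ V(G)
  link_left : ∃ x ∈ S, G.IsLink c a x
  link_right : ∃ y ∈ S, G.IsLink c' b y
  left_notMem : a ∉ S
  right_notMem : b ∉ S
  ne : a ≠ b
  edgeBoundary_eq : G.edgeBoundary S = {c, c'}

variable {c c' : β} {a b : α}

lemma IsTwoCut.ne' (h : G.IsTwoCut S c c' a b) : c ≠ c' := by
  rintro rfl
  obtain ⟨x, hx, h1⟩ := h.link_left
  obtain ⟨y, hy, h2⟩ := h.link_right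
  obtain h3 | h3 := h2.left_eq_or_eq h1
  · exact h.ne h3.symm
  · exact h.right_notMem (h3 ▸ hx)

/-- Delete `S` and let `c` be a new edge between `a` and `b`. -/
def cutReduce (G : Graph α β) (S : Set α) (c : β) (a b : α) : Graph α β where
  vertexSet := V(G) \ S
  IsLink e x y := (e ≠ c ∧ G.IsLink e x y ∧ x ∉ S ∧ y ∉ S) ∨
    (e = c ∧ s(x, y) = s(a, b) ∧ a ∈ V(G) \ S ∧ b ∈ V(G) \ S)
  isLink_symm := by
    rintro e -
    refine ⟨fun x y h ↦ ?_⟩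
    rw [Sym2.eq_swap, isLink_comm]
    tauto
  eq_or_eq_of_isLink_of_isLink := by
    rintro e x y v w (⟨h1, h2, -⟩ | ⟨h1, h2, -⟩) (⟨h3, h4, -⟩ | ⟨h3, h4, -⟩)
    · exact h2.left_eq_or_eq h4
    · exact absurd h3 h1
    · exact absurd h1 h3
    · rw [← h4, Sym2.eq_iff] at h2
      tauto
  left_mem_of_isLink := by
    rintro e x y (⟨-, h, hx, -⟩ | ⟨-, h, ha, hb⟩)
    · exact ⟨h.left_mem, hx⟩
    · rw [Sym2.eq_iff] at h
      obtain ⟨rfl, -⟩ | ⟨rfl, -⟩ := h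
      · exact ha
      · exact hb

/-- The side conditions in the definition are automatic for a two-cut: `c` has an end in `S`, so it
disappears with `S` and its label is free for the new edge. Thus no fresh element of `β` is ever
needed. -/
lemma IsTwoCut.cutReduce_isLink (h : G.IsTwoCut S c c' a b) {e : β} {x y : α} :
    (G.cutReduce S c a b).IsLink e x y ↔
      (G.IsLink e x y ∧ x ∉ S ∧ y ∉ S) ∨ (e = c ∧ s(x, y) = s(a, b)) := by
  obtain ⟨z, hz, hl⟩ := h.link_left
  obtain ⟨z', hz', hl'⟩ := h.link_right
  constructor
  · rintro (⟨-, h⟩ | ⟨h1, h2, -⟩)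
    · exact .inl h
    · exact .inr ⟨h1, h2⟩
  · rintro (⟨h1, h2, h3⟩ | ⟨h1, h2⟩)
    · refine .inl ⟨?_, h1, h2, h3⟩
      rintro rfl
      obtain rfl | rfl := hl.right_eq_or_eq h1 <;> contradiction
    · exact .inr ⟨h1, h2, ⟨hl.left_mem, h.left_notMem⟩, ⟨hl'.left_mem, h.right_notMem⟩⟩

open scoped Classical in
-- The new edge carries the label `c`. Placing `S` on the side of `b` keeps `c'` uncrossed, and then
-- `c` is crossed in `G` exactly when `a` and `b` are separated. This is an equality of edge sets,
-- not only of sizes.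
lemma IsTwoCut.edgeBoundary_cutReduce (h : G.IsTwoCut S c c' a b) (hX : Disjoint X S) :
    (G.cutReduce S c a b).edgeBoundary X =
      if b ∈ X then G.edgeBoundary (X ∪ S) else G.edgeBoundary X := by
  obtain ⟨z, hz, hl⟩ := h.link_left
  obtain ⟨z', hz', hl'⟩ := h.link_right
  have hXS : ∀ x ∈ X, x ∉ S := fun x hx hs ↦ Set.disjoint_left.1 hX hx hs
  have ha := h.left_notMem
  have hb := h.right_notMem
  have hzX : z ∉ X := fun h ↦ hXS _ h hz
  have hzX' : z' ∉ X := fun h ↦ hXS _ h hz'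
  ext e
  by_cases hec : e = c
  · subst hec
    have hl2 : (G.cutReduce S e a b).IsLink e a b := h.cutReduce_isLink.2 (.inr ⟨rfl, rfl⟩)
    rw [hl2.mem_edgeBoundary_iff]
    split_ifs with hbX
    · rw [hl.mem_edgeBoundary_iff]
      simp only [Set.mem_union]
      tauto
    · rw [hl.mem_edgeBoundary_iff]
      tauto
  have hR : e ∈ (G.cutReduce S c a b).edgeBoundary X ↔ ∃ x y, G.IsLink e x y ∧ x ∉ S ∧ y ∉ S ∧
      x ∈ X ∧ y ∉ X := by
    simp only [edgeBoundary, Set.mem_ofPred_eq, h.cutReduce_isLink]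
    refine exists₂_congr fun x y ↦ ?_
    tauto
  rw [hR]
  by_cases hec' : e = c'
  · subst hec'
    have h1 : ¬ ∃ x y, G.IsLink e x y ∧ x ∉ S ∧ y ∉ S ∧ x ∈ X ∧ y ∉ X := by
      rintro ⟨x, y, hxy, h1, h2, -⟩
      obtain rfl | rfl := hl'.right_eq_or_eq hxy <;> contradiction
    simp only [h1, false_iff]
    split_ifs with hbX <;> rw [hl'.mem_edgeBoundary_iff]
    · simp only [Set.mem_union]
      tauto
    · tauto
  have heS : ∀ x y, G.IsLink e x y → (x ∈ S ↔ y ∈ S) := by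
    intro x y hxy
    have : e ∉ G.edgeBoundary S := by
      rw [h.edgeBoundary_eq]; simp [hec, hec']
    rw [hxy.mem_edgeBoundary_iff] at this
    tauto
  split_ifs with hbX
  · refine exists₂_congr fun x y ↦ ?_
    constructor
    · rintro ⟨h1, h2, h3, h4, h5⟩
      exact ⟨h1, .inl h4, by simp [h3, h5]⟩
    · rintro ⟨h1, h2, h3⟩
      have := heS x y h1
      simp only [Set.mem_union] at h2 h3
      tauto
  · refine exists₂_congr fun x y ↦ ?_
    constructor
    · tauto
    · rintro ⟨h1, h2, h3⟩
      have := heS x y h1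
      have := hXS x h2
      tauto

lemma IsTwoCut.neighbors_eq (h : G.IsTwoCut S c c' a b) : G.neighbors S = {a, b} := by
  obtain ⟨z, hz, hl⟩ := h.link_left
  obtain ⟨z', hz', hl'⟩ := h.link_right
  have ha := h.left_notMem
  have hb := h.right_notMem
  ext w
  simp only [neighbors, Set.mem_ofPred_eq, Set.mem_sdiff, Set.mem_insert_iff, Set.mem_singleton_iff]
  constructor
  · rintro ⟨⟨hw, hwS⟩, x, hx, e, he⟩
    have : e ∈ G.edgeBoundary S := ⟨x, w, he.symm, hx, hwS⟩
    rw [h.edgeBoundary_eq] at this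
    obtain rfl | rfl := this
    · obtain rfl | rfl := he.left_eq_or_eq hl
      · exact .inl rfl
      · contradiction
    · obtain rfl | rfl := he.left_eq_or_eq hl'
      · exact .inr rfl
      · contradiction
  · rintro (rfl | rfl)
    · exact ⟨⟨hl.left_mem, ha⟩, z, hz, c, hl⟩
    · exact ⟨⟨hl'.left_mem, hb⟩, z', hz', c', hl'⟩

lemma IsTwoCut.even (h : G.IsTwoCut S c c' a b) (hr : Odd r) (hG : G.IsRGraph r) :
    Even S.ncard := by
  have h1 := odd_ncard_edgeBoundary hG.finite_edgeSet (hG.finite_vertexSet.subset h.subset)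
    fun x hx ↦ by rwa [hG.ncard_edgeBoundary_singleton (h.subset hx)]
  rw [h.edgeBoundary_eq, Set.ncard_pair h.ne'] at h1
  rw [← Nat.not_odd_iff_even, ← h1]
  decide

lemma IsTwoCut.isTwoCutReduction (h : G.IsTwoCut S c c' a b) (hr : Odd r) (hG : G.IsRGraph r) :
    G.IsTwoCutReduction S (G.cutReduce S c a b) := by
  refine ⟨h.subset, h.even hr hG, ?_, a, b, h.ne, h.neighbors_eq, c, ?_, rfl, fun f x y ↦ ?_⟩
  · rw [h.edgeBoundary_eq, Set.ncard_pair h.ne']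
  · intro hc
    obtain ⟨x, y, hxy⟩ := exists_isLink_of_mem_edgeSet hc
    rw [deleteVerts_isLink] at hxy
    obtain ⟨z, hz, hl⟩ := h.link_left
    obtain rfl | rfl := hl.right_eq_or_eq hxy.1
    · exact hxy.2.1 hz
    · exact hxy.2.2 hz
  · rw [h.cutReduce_isLink, deleteVerts_isLink]

lemma IsTwoCut.cutReduce_isConnected (h : G.IsTwoCut S c c' a b) (hG : G.IsConnected) :
    (G.cutReduce S c a b).IsConnected := by
  obtain ⟨z, hz, hl⟩ := h.link_left
  rw [isConnected_iff_edgeBoundary] at hG ⊢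
  refine ⟨⟨a, hl.left_mem, h.left_notMem⟩, fun X hX hne hXV ↦ ?_⟩
  have hd : Disjoint X S := Set.disjoint_of_subset_left hX disjoint_sdiff_self_left
  have hXV' : X ⊆ V(G) := hX.trans Set.sdiff_subset
  rw [h.edgeBoundary_cutReduce hd]
  split_ifs
  · refine hG.2 _ (Set.union_subset hXV' h.subset) (hne.mono Set.subset_union_left) fun heq ↦
      hXV ?_
    change X = V(G) \ S
    rw [← heq, Set.union_sdiff_right, hd.sdiff_eq_left]
  · refine hG.2 _ hXV' hne ?_
    rintro rfl
    exact Set.disjoint_left.1 hd (h.subset hz) hz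

/-- Every cut of the reduction is a cut of `G` at `X` or at `X ∪ S`, and `S` is even, so odd sets
stay odd. At `b` the degree is `r + 2 - 2`, since `∂{b}` and `∂S` share only `c'`. -/
lemma IsTwoCut.cutReduce_isRGraph (h : G.IsTwoCut S c c' a b) (hr : Odd r) (hG : G.IsRGraph r) :
    (G.cutReduce S c a b).IsRGraph r := by
  obtain ⟨z', hz', hl'⟩ := h.link_right
  have hSe := h.even hr hG
  have hS2 : (G.edgeBoundary S).ncard = 2 := by rw [h.edgeBoundary_eq, Set.ncard_pair h.ne']
  have hGl := hG.loopless
  have : (G.cutReduce S c a b).Loopless := by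
    refine ⟨fun e x hl ↦ ?_⟩
    obtain h1 | ⟨-, h2⟩ := h.cutReduce_isLink.1 hl
    · exact h1.1.ne rfl
    · rw [Sym2.eq_iff] at h2
      have := h.ne
      grind
  refine isRGraph_of_edgeBoundary (hG.finite_vertexSet.subset Set.sdiff_subset) ?_ ?_ ?_
  · refine hG.finite_edgeSet.subset fun e he ↦ ?_
    obtain ⟨x, y, hxy⟩ := exists_isLink_of_mem_edgeSet he
    obtain h1 | ⟨rfl, -⟩ := h.cutReduce_isLink.1 hxy
    · exact h1.1.edge_mem
    · obtain ⟨z, hz, hl⟩ := h.link_left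
      exact hl.edge_mem
  · intro x hx
    have hd : Disjoint {x} S := Set.disjoint_singleton_left.2 hx.2
    have hxr := hG.ncard_edgeBoundary_singleton hx.1
    rw [h.edgeBoundary_cutReduce hd]
    split_ifs with hb
    · obtain rfl : b = x := hb
      have h1 := ncard_edgeBoundary_union hG.finite_edgeSet hd
      have h2 : G.edgeBoundary {b} ∩ G.edgeBoundary S = {c'} := by
        obtain ⟨z, hz, hl⟩ := h.link_left
        ext e
        rw [h.edgeBoundary_eq]
        constructor
        · rintro ⟨h3, rfl | rfl⟩
          · rw [hl.mem_edgeBoundary_iff] at h3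
            have h4 := h.ne
            have h5 := h.right_notMem
            exfalso
            simp only [Set.mem_singleton_iff] at h3
            grind
          · rfl
        · rintro rfl
          exact ⟨hl'.mem_edgeBoundary_iff.2 (.inl ⟨rfl, fun h4 ↦ h.right_notMem (h4 ▸ hz')⟩),
            by simp⟩
      rw [h2, Set.ncard_singleton] at h1
      omega
    · exact hxr
  · intro X hX ho
    have hd : Disjoint X S := Set.disjoint_of_subset_left hX disjoint_sdiff_self_left
    have hXV' : X ⊆ V(G) := hX.trans Set.sdiff_subset
    rw [h.edgeBoundary_cutReduce hd]
    split_ifs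
    · refine hG.le_boundary _ (Set.union_subset hXV' h.subset) ?_
      rw [Set.ncard_union_eq hd (hG.finite_vertexSet.subset hXV')
        (hG.finite_vertexSet.subset h.subset)]
      exact ho.add_even hSe
    · exact hG.le_boundary _ hXV' ho

/-- Simultaneous reduction of finitely many disjoint two-edge cuts. -/
lemma exists_reduction_of_isTwoCut {ι : Type*}
    {A : ∀ (α : Type u) (β : Type v), Graph α β → Prop} (hA : PreservedByTwoCutReduction A r)
    (hr : Odd r) (hG : G.IsRGraph r) (hGc : G.IsConnected) (hGA : A α β G)
    (F : Finset ι) (S : ι → Set α) (c c' : ι → β) (a b : ι → α)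
    (h : ∀ i ∈ F, G.IsTwoCut (S i) (c i) (c' i) (a i) (b i))
    (hdisj : ∀ i ∈ F, ∀ j ∈ F, i ≠ j → Disjoint (S i) (S j))
    (ha : ∀ i ∈ F, ∀ j ∈ F, a i ∉ S j) (hb : ∀ i ∈ F, ∀ j ∈ F, b i ∉ S j) :
    ∃ R : Graph α β, A α β R ∧ R.IsRGraph r ∧ R.IsConnected ∧
      V(R) = {x ∈ V(G) | ∀ i ∈ F, x ∉ S i} ∧ ∀ e x y, R.IsLink e x y ↔
        (G.IsLink e x y ∧ (∀ i ∈ F, x ∉ S i) ∧ ∀ i ∈ F, y ∉ S i) ∨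
          ∃ i ∈ F, e = c i ∧ s(x, y) = s(a i, b i) := by
  classical
  induction F using Finset.induction_on with
  | empty => exact ⟨G, hGA, hG, hGc, by simp, by simp⟩
  | @insert i F hi ih =>
    have hF : ∀ {j}, j ∈ F → j ∈ insert i F := Finset.mem_insert_of_mem
    have him := Finset.mem_insert_self i F
    obtain ⟨R, hRA, hR, hRc, hRV, hRl⟩ := ih (fun j hj ↦ h j (hF hj))
      (fun j hj k hk ↦ hdisj j (hF hj) k (hF hk)) (fun j hj k hk ↦ ha j (hF hj) k (hF hk))
      (fun j hj k hk ↦ hb j (hF hj) k (hF hk))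
    have hSi : ∀ x ∈ S i, ∀ j ∈ F, x ∉ S j := fun x hx j hj hxj ↦
      Set.disjoint_left.1 (hdisj i him j (hF hj) (by rintro rfl; exact hi hj)) hx hxj
    have hi' := h i him
    -- The earlier reductions remove sets disjoint from `S i` that avoid `a i` and `b i`, and their
    -- new edges have both ends outside `S i`, so the cut around `S i` survives.
    have hcut : R.IsTwoCut (S i) (c i) (c' i) (a i) (b i) := by
      refine ⟨fun x hx ↦ hRV ▸ ⟨hi'.subset hx, hSi x hx⟩, ?_, ?_, hi'.left_notMem,
        hi'.right_notMem, hi'.ne, ?_⟩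
      · obtain ⟨x, hx, hl⟩ := hi'.link_left
        exact ⟨x, hx, (hRl ..).2 (.inl ⟨hl, fun j hj ↦ ha i him j (hF hj), hSi x hx⟩)⟩
      · obtain ⟨x, hx, hl⟩ := hi'.link_right
        exact ⟨x, hx, (hRl ..).2 (.inl ⟨hl, fun j hj ↦ hb i him j (hF hj), hSi x hx⟩)⟩
      · rw [← hi'.edgeBoundary_eq]
        ext e
        constructor
        · rintro ⟨x, y, hl, hx, hy⟩
          obtain ⟨hl, -⟩ | ⟨j, hj, -, hs⟩ := (hRl ..).1 hl
          · exact ⟨x, y, hl, hx, hy⟩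
          · exfalso
            have h1 := ha j (hF hj) i him
            have h2 := hb j (hF hj) i him
            rw [Sym2.eq_iff] at hs
            grind
        · intro he
          have he' := he
          rw [hi'.edgeBoundary_eq] at he'
          obtain ⟨x, y, hl, hx, hy⟩ := he
          refine ⟨x, y, (hRl ..).2 (.inl ⟨hl, hSi x hx, ?_⟩), hx, hy⟩
          obtain rfl | rfl := he'
          · obtain ⟨z, hz, hlz⟩ := hi'.link_left
            obtain rfl | rfl := hl.right_eq_or_eq hlz
            · exact fun j hj ↦ ha i him j (hF hj)
            · contradiction
          · obtain ⟨z, hz, hlz⟩ := hi'.link_right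
            obtain rfl | rfl := hl.right_eq_or_eq hlz
            · exact fun j hj ↦ hb i him j (hF hj)
            · contradiction
    refine ⟨R.cutReduce (S i) (c i) (a i) (b i),
      hA _ _ _ _ _ hR hRc (hcut.isTwoCutReduction hr hR) hRA, hcut.cutReduce_isRGraph hr hR,
      hcut.cutReduce_isConnected hRc, ?_, fun e x y ↦ ?_⟩
    · change V(R) \ S i = _
      rw [hRV]
      ext x
      simp only [Set.mem_sdiff, Set.mem_ofPred_eq, Finset.forall_mem_insert]
      tauto
    · rw [hcut.cutReduce_isLink, hRl]
      simp only [Finset.forall_mem_insert, Finset.exists_mem_insert]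
      constructor
      · rintro (⟨h1 | ⟨j, hj, h1⟩, h2, h3⟩ | h1)
        · exact .inl (by tauto)
        · exact .inr (.inr ⟨j, hj, h1⟩)
        · exact .inr (.inl h1)
      · rintro (h1 | h1 | ⟨j, hj, h1⟩)
        · exact .inl (by tauto)
        · exact .inr h1
        · refine .inl ⟨.inr ⟨j, hj, h1⟩, ?_⟩
          have h3 := ha j (hF hj) i him
          have h4 := hb j (hF hj) i him
          have h2 := h1.2
          rw [Sym2.eq_iff] at h2
          grind

end Graph

/-! ### Trees given by a parent function, and the case `r = 1`. -/

namespace Graph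

variable {α : Type u} {β : Type v} {G : Graph α β} {S X Y : Set α} {e : β} {x y : α} {r : ℕ}

/-- `T` is presented as a tree with root `a`: every other vertex `x` is linked by the edge
`edge x` to its parent, and there are no other edges. -/
structure IsParentTree (T : Graph α β) (a : α) (parent : α → α) (edge : α → β)
    (depth : α → ℕ) : Prop where
  root_mem : a ∈ V(T)
  depth_root : depth a = 0
  isLink_parent : ∀ x ∈ V(T), x ≠ a → T.IsLink (edge x) x (parent x)
  depth_parent : ∀ x ∈ V(T), x ≠ a → depth (parent x) + 1 = depth x
  eq_of_isLink : ∀ e x y, T.IsLink e x y →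
    (x ≠ a ∧ e = edge x ∧ y = parent x) ∨ (y ≠ a ∧ e = edge y ∧ x = parent y)

namespace IsParentTree

variable {T : Graph α β} {a : α} {parent : α → α} {edge : α → β} {depth : α → ℕ}

lemma depth_isLink (h : T.IsParentTree a parent edge depth) (hl : T.IsLink e x y) :
    depth x = depth y + 1 ∨ depth y = depth x + 1 := by
  obtain ⟨h1, -, rfl⟩ | ⟨h1, -, rfl⟩ := h.eq_of_isLink e x y hl
  · exact .inl (h.depth_parent x hl.left_mem h1).symm
  · exact .inr (h.depth_parent y hl.right_mem h1).symm

/-- Adjacent vertices differ in depth by one, which excludes loops; parallel edges are both the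
parent edge of their common deeper end. -/
lemma simple (h : T.IsParentTree a parent edge depth) : T.Simple where
  not_isLoopAt e x hl := by
    have := h.depth_isLink hl
    omega
  eq_of_isLink e f x y he hf := by
    have hx := h.depth_parent x he.left_mem
    have hy := h.depth_parent y he.right_mem
    obtain ⟨h1, h2, h3⟩ | ⟨h1, h2, h3⟩ := h.eq_of_isLink e x y he <;>
    obtain ⟨h4, h5, h6⟩ | ⟨h4, h5, h6⟩ := h.eq_of_isLink f x y hf
    · rw [h2, h5]
    · rw [← h3] at hx; rw [← h6] at hy; have := hx h1; have := hy h4; omega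
    · rw [← h6] at hx; rw [← h3] at hy; have := hx h4; have := hy h1; omega
    · rw [h2, h5]

lemma exists_walk (h : T.IsParentTree a parent edge depth) (x : V(T)) :
    ∃ w : T.toSimpleGraph.Walk ⟨a, h.root_mem⟩ x, w.length = depth x := by
  obtain ⟨n, hn⟩ : ∃ n, depth x = n := ⟨_, rfl⟩
  induction n generalizing x with
  | zero =>
    by_cases hx : (x : α) = a
    · obtain ⟨x, hx'⟩ := x
      subst hx
      exact ⟨.nil, by simp [hn]⟩
    · have := h.depth_parent x x.2 hx
      omega
  | succ n ih =>
    have hx : (x : α) ≠ a := by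
      intro hx
      have := h.depth_root
      rw [hx] at hn
      omega
    have hl := h.isLink_parent x x.2 hx
    have hd := h.depth_parent x x.2 hx
    obtain ⟨w, hw⟩ := ih ⟨parent x, hl.right_mem⟩ (by simp only; omega)
    have := h.simple
    have hadj : T.toSimpleGraph.Adj ⟨parent x, hl.right_mem⟩ x :=
      (toSimpleGraph_adj_iff ..).2 ⟨_, hl.symm⟩
    refine ⟨w.concat hadj, ?_⟩
    rw [SimpleGraph.Walk.length_concat, hw]
    exact hd

lemma le_length (h : T.IsParentTree a parent edge depth) {x y : V(T)}
    (w : T.toSimpleGraph.Walk x y) : depth y ≤ depth x + w.length := by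
  induction w with
  | nil => simp
  | cons hadj w ih =>
    obtain ⟨e, hl⟩ := hadj.2
    have := h.depth_isLink hl
    rw [SimpleGraph.Walk.length_cons]
    omega

/-- Following parents gives a walk of length `depth x`, and no walk is shorter because depth changes
by one along each edge. -/
lemma dist_eq (h : T.IsParentTree a parent edge depth) (x : V(T)) :
    T.toSimpleGraph.dist ⟨a, h.root_mem⟩ x = depth x := by
  obtain ⟨w, hw⟩ := h.exists_walk x
  refine le_antisymm (hw ▸ SimpleGraph.dist_le w) ?_
  obtain ⟨w', hw'⟩ := SimpleGraph.Reachable.exists_walk_length_eq_dist ⟨w⟩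
  have := h.le_length w'
  rw [h.depth_root] at this
  omega

lemma isConnected (h : T.IsParentTree a parent edge depth) : T.IsConnected := by
  have : Nonempty V(T) := ⟨⟨a, h.root_mem⟩⟩
  have key : ∀ x, T.toSimpleGraph.Reachable ⟨a, h.root_mem⟩ x := fun x ↦
    ⟨(h.exists_walk x).choose⟩
  exact ⟨fun x y ↦ (key x).symm.trans (key y)⟩

/-- Connectedness plus counting: sending a vertex to its parent edge is a bijection from the
non-root vertices to the edges. -/
lemma isTree (h : T.IsParentTree a parent edge depth) (hV : V(T).Finite) : T.IsTree := by
  have := h.simple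
  refine ⟨this, ?_⟩
  have hfin : Finite V(T) := hV
  refine (SimpleGraph.isTree_iff_connected_and_card).2 ⟨h.isConnected, ?_⟩
  let a' : V(T) := ⟨a, h.root_mem⟩
  let f : {x : V(T) // x ≠ a'} → T.toSimpleGraph.edgeSet := fun x ↦
    ⟨s(x.1, ⟨parent x.1, (h.isLink_parent x.1 x.1.2
      fun hx ↦ x.2 (Subtype.ext hx)).right_mem⟩),
      (toSimpleGraph_adj_iff ..).2 ⟨_, h.isLink_parent x.1 x.1.2 fun hx ↦ x.2 (Subtype.ext hx)⟩⟩
  have hf : Function.Bijective f := by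
    constructor
    · rintro ⟨x, hx⟩ ⟨y, hy⟩ hxy
      have h1 := congrArg Subtype.val hxy
      have hx' : (x : α) ≠ a := fun hx' ↦ hx (Subtype.ext hx')
      have hy' : (y : α) ≠ a := fun hx' ↦ hy (Subtype.ext hx')
      have hdx := h.depth_parent x x.2 hx'
      have hdy := h.depth_parent y y.2 hy'
      rw [Sym2.eq_iff] at h1
      obtain ⟨h1, -⟩ | ⟨h1, h2⟩ := h1
      · exact Subtype.ext h1
      · have h3 : (x : α) = parent y := congrArg Subtype.val h1
        have h4 : parent x = y := congrArg Subtype.val h2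
        rw [h4] at hdx
        rw [← h3] at hdy
        omega
    · rintro ⟨p, hp⟩
      induction p using Sym2.ind with
      | _ x y =>
        obtain ⟨e, hl⟩ := (toSimpleGraph_adj_iff x y).1 hp
        obtain ⟨h1, h2, h3⟩ | ⟨h1, h2, h3⟩ := h.eq_of_isLink e x y hl
        · refine ⟨⟨x, fun hx ↦ h1 (congrArg Subtype.val hx)⟩, Subtype.ext ?_⟩
          exact congrArg (fun z ↦ s(x, z)) (Subtype.ext h3.symm)
        · refine ⟨⟨y, fun hx ↦ h1 (congrArg Subtype.val hx)⟩, Subtype.ext ?_⟩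
          exact Sym2.eq_swap.trans (congrArg (fun z ↦ s(z, y)) (Subtype.ext h3.symm))
  rw [← Nat.card_eq_of_bijective f hf]
  have := Fintype.ofFinite V(T)
  classical
  rw [Nat.card_eq_fintype_card, Nat.card_eq_fintype_card, Fintype.card_subtype_compl,
    Fintype.card_subtype_eq]
  have : 0 < Fintype.card V(T) := Fintype.card_pos_iff.2 ⟨a'⟩
  omega

end IsParentTree

lemma isAutomorphism_of_equiv (f : α ≃ α) (g : β ≃ β) (hf : ∀ x, f x ∈ V(G) ↔ x ∈ V(G))
    (h : ∀ e x y, G.IsLink (g e) (f x) (f y) ↔ G.IsLink e x y) : G.IsAutomorphism f := by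
  refine ⟨⟨fun x hx ↦ (hf x).2 hx, f.injective.injOn, fun x hx ↦ ⟨f.symm x, ?_, by simp⟩⟩,
    fun x _ y _ ↦ ?_⟩
  · rw [← hf]; simpa using hx
  · unfold edgeCount
    rw [← Set.ncard_image_of_injective {e | G.IsLink e x y} g.injective]
    refine congrArg Set.ncard (Set.ext fun e ↦ ?_)
    constructor
    · intro he
      refine ⟨g.symm e, ?_, by simp⟩
      rw [Set.mem_ofPred_eq, ← h]
      simpa using he
    · rintro ⟨e, he, rfl⟩
      exact (h ..).2 he

/-- Here `G` is `K₂`, its own spanning tree, and the identity has the required period `1`. The case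
is separate because the general construction would contain `r / 2 = 0` copies of `G`. -/
lemma IsRGraph.isRotationRGraph_of_one (hG : G.IsRGraph 1) (hc : G.IsConnected) :
    G.IsRotationRGraph 1 ∧ G.Simple := by
  have := hG.loopless
  obtain ⟨⟨a, ha⟩, hcut⟩ := isConnected_iff_edgeBoundary.1 hc
  have hone : ∀ x ∈ V(G), ∀ e f y z, G.IsLink e x y → G.IsLink f x z → e = f ∧ y = z := by
    intro x hx e f y z he hf
    have h1 := hG.ncard_edgeBoundary_singleton hx
    obtain ⟨c, hc⟩ := Set.ncard_eq_one.1 h1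
    have he' : e ∈ G.edgeBoundary {x} := he.mem_edgeBoundary_iff.2 (.inl ⟨rfl, he.ne.symm⟩)
    have hf' : f ∈ G.edgeBoundary {x} := hf.mem_edgeBoundary_iff.2 (.inl ⟨rfl, hf.ne.symm⟩)
    rw [hc] at he' hf'
    obtain rfl : e = f := he'.trans hf'.symm
    exact ⟨rfl, he.right_unique hf⟩
  obtain ⟨c, hc1⟩ := Set.ncard_eq_one.1 (hG.ncard_edgeBoundary_singleton ha)
  obtain ⟨a', b, hl, rfl, hb⟩ : c ∈ G.edgeBoundary {a} := hc1 ▸ rfl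
  -- Both ends of `c` have no further edge, so `{a', b}` has empty boundary.
  have hV : V(G) = {a', b} := by
    by_contra hne
    obtain ⟨e, x, y, he, hx, hy⟩ := hcut {a', b}
      (Set.insert_subset ha (Set.singleton_subset_iff.2 hl.right_mem)) ⟨a', by simp⟩
      (fun h ↦ hne h.symm)
    obtain rfl | rfl := hx
    · exact hy (.inr (hone _ ha _ _ _ _ he hl).2)
    · exact hy (.inl (hone _ hl.right_mem _ _ _ _ he hl.symm).2)
  have hT : G.IsParentTree a' (fun _ ↦ a') (fun _ ↦ c)
      (by classical exact fun x ↦ if x = a' then 0 else 1) := by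
    refine ⟨ha, by simp, ?_, ?_, ?_⟩
    · intro x hx hxa
      rw [hV] at hx
      obtain rfl | rfl := hx
      · exact absurd rfl hxa
      · exact hl.symm
    · intro x hx hxa
      simp [hxa]
    · intro e x y he
      have hx := he.left_mem
      rw [hV] at hx
      obtain rfl | rfl := hx
      · obtain ⟨rfl, rfl⟩ := hone _ ha _ _ _ _ he hl
        exact .inr ⟨hb, rfl, rfl⟩
      · obtain ⟨rfl, rfl⟩ := hone _ hl.right_mem _ _ _ _ he hl.symm
        exact .inl ⟨hb, rfl, rfl⟩
  have hid : G.IsAutomorphism id :=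
    isAutomorphism_of_equiv (Equiv.refl α) (Equiv.refl β) (by simp) (by simp)
  refine ⟨⟨hG, 1, G, ⟨a', ha⟩, id, .rfl, ⟨hT.isTree hG.finite_vertexSet,
    fun x ↦ .inl (hG.deg_eq x x.2), hG.deg_eq a' ha, fun x hx _ ↦ ?_⟩, hid, hid, ?_, ?_⟩, hT.simple⟩
  · rw [hT.dist_eq]
    have : (x : α) ≠ a' := fun h ↦ hx (Subtype.ext h)
    simp [this]
  · simp [Function.minimalPeriod_id]
  · intro x hx _
    rw [hG.deg_eq a' ha, Function.minimalPeriod_id]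

end Graph

/-! ### Levels with respect to a base edge. -/

namespace Graph

/-- A multigraph in which every edge has a first end `ends f false` and a second end
`ends f true`, together with the distances `level` to the set of ends of a base edge and, for
every vertex `z` of positive level, an edge `up z` leading to a vertex of the previous level. -/
structure Layered (V : Type u) (E : Type v) where
  /-- The two ends of an edge. -/
  ends : E → Bool → V
  /-- The base edge. -/
  base : E
  /-- The distance to the ends of the base edge. -/
  level : V → ℕ
  /-- An edge leading to the previous level. -/
  up : V → E
  ends_ne : ∀ f, ends f false ≠ ends f true
  level_base : ∀ b, level (ends base b) = 0
  eq_of_level : ∀ z, level z = 0 → z = ends base false ∨ z = ends base true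
  level_le : ∀ f, level (ends f false) ≤ level (ends f true)
  le_level : ∀ f, level (ends f true) ≤ level (ends f false) + 1
  ends_up : ∀ z, level z ≠ 0 → ends (up z) true = z
  level_up : ∀ z, level z ≠ 0 → level (ends (up z) false) + 1 = level z

namespace Layered

variable {V : Type u} {E : Type v}

/-- The underlying multigraph. -/
def graph (Γ : Layered V E) : Graph V E where
  vertexSet := Set.univ
  IsLink f x y := s(x, y) = s(Γ.ends f false, Γ.ends f true)
  isLink_symm := fun f _ ↦ ⟨fun x y h ↦ by rwa [Sym2.eq_swap]⟩
  eq_or_eq_of_isLink_of_isLink := by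
    intro f x y z w h1 h2
    rw [← h2, Sym2.eq_iff] at h1
    tauto
  left_mem_of_isLink := fun _ _ _ _ ↦ Set.mem_univ _

lemma isLink_ends (Γ : Layered V E) (f : E) : Γ.graph.IsLink f (Γ.ends f false) (Γ.ends f true) :=
  rfl

/-- Renaming vertices and edges. -/
def congr {V' : Type*} {E' : Type*} (Γ : Layered V E) (φ : V ≃ V') (g : E ≃ E') :
    Layered V' E' where
  ends f b := φ (Γ.ends (g.symm f) b)
  base := g Γ.base
  level z := Γ.level (φ.symm z)
  up z := g (Γ.up (φ.symm z))
  ends_ne f := by simpa using Γ.ends_ne _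
  level_base b := by simpa using Γ.level_base b
  eq_of_level z hz := by simpa [Equiv.symm_apply_eq] using Γ.eq_of_level _ hz
  level_le f := by simpa using Γ.level_le _
  le_level f := by simpa using Γ.le_level _
  ends_up z hz := by
    rw [g.symm_apply_apply, Γ.ends_up _ hz, φ.apply_symm_apply]
  level_up z hz := by simpa using Γ.level_up _ hz

end Layered

lemma _root_.SimpleGraph.Connected.dist_le_dist_add_one {V : Type*} {H : SimpleGraph V}
    (hH : H.Connected) {x y : V} (h : H.Adj x y) (z : V) : H.dist z y ≤ H.dist z x + 1 := by
  have h1 := hH.dist_triangle (u := z) (v := x) (w := y)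
  rwa [SimpleGraph.dist_eq_one_iff_adj.2 h] at h1

/-- The penultimate vertex of a shortest walk works. -/
lemma _root_.SimpleGraph.Connected.exists_adj_dist {V : Type*} {H : SimpleGraph V}
    (hH : H.Connected) {x z : V} (h : H.dist x z ≠ 0) :
    ∃ y, H.Adj y z ∧ H.dist x y + 1 = H.dist x z := by
  obtain ⟨w, hw⟩ := hH.exists_walk_length_eq_dist x z
  have hn : ¬ w.Nil := by
    intro hn
    rw [← SimpleGraph.Walk.length_eq_zero_iff] at hn
    omega
  refine ⟨w.penultimate, w.adj_penultimate hn, ?_⟩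
  have h1 := hH.dist_le_dist_add_one (w.adj_penultimate hn) x
  have h2 := SimpleGraph.dist_le w.dropLast
  have h3 : w.dropLast.length + 1 = w.length := by
    rw [SimpleGraph.Walk.length_dropLast_add_one hn]
  omega

variable {α : Type u} {β : Type v} {G : Graph α β} {r : ℕ}

/-- The level is the distance to the nearer end of an arbitrary edge `ab`. Every edge is directed
from its lower to its higher end, the direction being arbitrary for equal levels. -/
lemma IsConnected.exists_layered [G.Loopless] (hG : G.IsConnected) (hE : E(G).Nonempty) :
    ∃ Γ : Layered V(G) E(G), ∀ (f : E(G)) (x y : V(G)),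
      G.IsLink f x y ↔ Γ.graph.IsLink f x y := by
  classical
  have hH : G.toSimpleGraph.Connected := hG
  have hends : ∀ f : E(G), ∃ x y : V(G), G.IsLink f x y := by
    intro f
    obtain ⟨x, y, h⟩ := exists_isLink_of_mem_edgeSet f.2
    exact ⟨⟨x, h.left_mem⟩, ⟨y, h.right_mem⟩, h⟩
  obtain ⟨e, he⟩ := hE
  obtain ⟨a, b, hab⟩ := hends ⟨e, he⟩
  let level : V(G) → ℕ := fun z ↦ min (G.toSimpleGraph.dist a z) (G.toSimpleGraph.dist b z)
  have hlip : ∀ (f : E(G)) (x y : V(G)), G.IsLink f x y → level y ≤ level x + 1 := by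
    intro f x y h
    have hadj : G.toSimpleGraph.Adj x y := (toSimpleGraph_adj_iff ..).2 ⟨f, h⟩
    have h1 := hH.dist_le_dist_add_one hadj a
    have h2 := hH.dist_le_dist_add_one hadj b
    simp only [level]
    omega
  have hup : ∀ z, level z ≠ 0 → ∃ (f : E(G)) (y : V(G)), G.IsLink f y z ∧ level y + 1 = level z := by
    intro z hz
    -- Applied with `x` the one of `a` and `b` that realises the minimum at `z`.
    have aux : ∀ x, G.toSimpleGraph.dist x z = level z →
        (∀ y, level y ≤ G.toSimpleGraph.dist x y) →
        ∃ (f : E(G)) (y : V(G)), G.IsLink f y z ∧ level y + 1 = level z := by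
      intro x hx hxy
      obtain ⟨y, h1, h2⟩ := hH.exists_adj_dist (hx ▸ hz)
      obtain ⟨f, hf⟩ := (toSimpleGraph_adj_iff ..).1 h1
      have h3 := hlip ⟨f, hf.edge_mem⟩ y z hf
      have h4 := hxy y
      exact ⟨⟨f, hf.edge_mem⟩, y, hf, by omega⟩
    obtain h | h := min_choice (G.toSimpleGraph.dist a z) (G.toSimpleGraph.dist b z)
    · exact aux a h.symm fun y ↦ min_le_left _ _
    · exact aux b h.symm fun y ↦ min_le_right _ _
  have hor : ∀ f : E(G), ∃ en : Bool → V(G), G.IsLink f (en false) (en true) ∧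
      level (en false) ≤ level (en true) := by
    intro f
    obtain ⟨x, y, h⟩ := hends f
    obtain hle | hle := le_total (level x) (level y)
    · exact ⟨fun b ↦ cond b y x, h, hle⟩
    · exact ⟨fun b ↦ cond b x y, h.symm, hle⟩
  choose en hen hle using hor
  have hup' : ∀ z, ∃ f : E(G), level z ≠ 0 →
      en f true = z ∧ level (en f false) + 1 = level z := by
    intro z
    by_cases hz : level z = 0
    -- At level zero the value of `up` is irrelevant.
    · exact ⟨⟨e, he⟩, fun h ↦ absurd hz h⟩
    · obtain ⟨f, y, h1, h2⟩ := hup z hz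
      refine ⟨f, fun _ ↦ ?_⟩
      obtain ⟨h3, h4⟩ | ⟨h3, h4⟩ := (hen f).eq_and_eq_or_eq_and_eq h1
      · rw [← Subtype.ext_iff] at h3 h4
        rw [h3, h4]; exact ⟨rfl, h2⟩
      · rw [← Subtype.ext_iff] at h3 h4
        have := hle f
        rw [h3, h4] at this
        omega
  choose up hup1 using hup'
  have hbase := (hen ⟨e, he⟩).eq_and_eq_or_eq_and_eq hab
  simp only [← Subtype.ext_iff] at hbase
  refine ⟨⟨en, ⟨e, he⟩, level, up, fun f h ↦ (hen f).ne (congrArg _ h), fun c ↦ ?_, fun z hz ↦ ?_,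
    hle, fun f ↦ hlip f _ _ (hen f), fun z hz ↦ (hup1 z hz).1, fun z hz ↦ (hup1 z hz).2⟩, ?_⟩
  · have ha : level a = 0 := by simp [level]
    have hb : level b = 0 := by simp [level]
    obtain ⟨h1, h2⟩ | ⟨h1, h2⟩ := hbase <;> cases c <;> simp only [h1, h2, ha, hb]
  · have : z = a ∨ z = b := by
      obtain h | h := min_choice (G.toSimpleGraph.dist a z) (G.toSimpleGraph.dist b z)
      · exact .inl ((hH.dist_eq_zero_iff.1 (h.symm.trans hz)).symm)
      · exact .inr ((hH.dist_eq_zero_iff.1 (h.symm.trans hz)).symm)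
    obtain ⟨h1, h2⟩ | ⟨h1, h2⟩ := hbase <;> rw [h1, h2]
    · exact this
    · exact this.symm
  · intro f x y
    rw [(hen f).isLink_iff_sym2_eq, eq_comm]
    change _ ↔ s(x, y) = s(en f false, en f true)
    rw [Sym2.eq_iff, Sym2.eq_iff]
    simp only [Subtype.ext_iff]

/-- A finite connected multigraph with an edge is isomorphic to a layered one on small types. -/
lemma IsRGraph.exists_layered (hG : G.IsRGraph r) (hr : 0 < r) (hc : G.IsConnected) :
    ∃ (n m : ℕ) (Γ : Layered (Fin n) (Fin m)), Γ.graph.IsRGraph r ∧ Γ.graph.Isomorphic G := by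
  have := hG.loopless
  have hE : E(G).Nonempty := by
    obtain ⟨⟨a, ha⟩⟩ := hc.nonempty
    have h1 := hG.ncard_edgeBoundary_singleton ha
    obtain ⟨e, he⟩ := Set.nonempty_of_ncard_ne_zero (h1 ▸ hr.ne')
    exact ⟨e, edgeBoundary_subset he⟩
  obtain ⟨Γ, hΓ⟩ := hc.exists_layered hE
  have : Finite V(G) := hG.finite_vertexSet
  have : Finite E(G) := hG.finite_edgeSet
  -- Over `Fin n` and `Fin m`, which lie in `Type`, the rotation graph can be formed with vertices
  -- in `Type u` and edges in `Type v`, where the property is defined.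
  obtain ⟨n, ⟨φ⟩⟩ := Finite.exists_equiv_fin V(G)
  obtain ⟨m, ⟨g⟩⟩ := Finite.exists_equiv_fin E(G)
  have hl : ∀ f x y, (Γ.congr φ g).graph.IsLink f x y ↔
      G.IsLink (g.symm f) (φ.symm x) (φ.symm y) := by
    intro f x y
    rw [hΓ]
    change s(x, y) = s(φ _, φ _) ↔ s(_, _) = s(_, _)
    simp only [Sym2.eq_iff, Equiv.symm_apply_eq]
  let φ' : Fin n → α := fun x ↦ φ.symm x
  let g' : Fin m → β := fun x ↦ g.symm x
  have hφ' : Function.Injective φ' := Subtype.val_injective.comp φ.symm.injective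
  have hg' : Function.Injective g' := Subtype.val_injective.comp g.symm.injective
  have hbd : ∀ X, G.edgeBoundary (φ' '' X) = g' '' ((Γ.congr φ g).graph.edgeBoundary X) := by
    intro X
    ext e
    constructor
    · rintro ⟨x, y, he, ⟨x, hx, rfl⟩, hy⟩
      have he' : g' (g ⟨e, he.edge_mem⟩) = e := by simp [g']
      have hy' : φ' (φ ⟨y, he.right_mem⟩) = y := by simp [φ']
      refine ⟨g ⟨e, he.edge_mem⟩, ⟨x, φ ⟨y, he.right_mem⟩, ?_, hx, fun h ↦ hy ⟨_, h, hy'⟩⟩, he'⟩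
      rw [hl]
      simpa using he
    · rintro ⟨f, ⟨x, y, hf, hx, hy⟩, rfl⟩
      refine ⟨φ' x, φ' y, (hl ..).1 hf, ⟨x, hx, rfl⟩, ?_⟩
      rwa [hφ'.mem_set_image]
  have hloop : (Γ.congr φ g).graph.Loopless := by
    refine ⟨fun e x h ↦ ?_⟩
    exact ((hl ..).1 h).ne rfl
  refine ⟨n, m, Γ.congr φ g, isRGraph_of_edgeBoundary (Set.toFinite _) (Set.toFinite _) ?_ ?_, ?_⟩
  · intro x _
    rw [← Set.ncard_image_of_injective _ hg', ← hbd, Set.image_singleton,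
      hG.ncard_edgeBoundary_singleton (φ.symm x).2]
  · intro X _ ho
    rw [← Set.ncard_image_of_injective _ hg', ← hbd]
    refine hG.le_boundary _ ?_ (by rwa [Set.ncard_image_of_injective _ hφ'])
    rintro _ ⟨x, -, rfl⟩
    exact (φ.symm x).2
  · have hE' : ∀ f, f ∈ E((Γ.congr φ g).graph) := fun f ↦ (Layered.isLink_ends _ f).edge_mem
    refine ⟨(Equiv.Set.univ _).trans φ.symm, (Equiv.subtypeUnivEquiv hE').trans g.symm, ?_⟩
    intro e x y
    exact hl ..

end Graph

/-! ### The rotation graph, its spanning tree, and simplicity. -/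

namespace Graph

namespace Layered

/-- Vertices of the rotation graph of a layered graph. -/
inductive Vtx.{w} (V E : Type) (r : ℕ) : Type w
  | root : Vtx V E r
  | rim (j : ZMod r) : Vtx V E r
  | orig (j : ZMod r) (k : Fin (r / 2)) (z : V) : Vtx V E r
  -- The word `w` has nonzero letters and is read towards the root: the children of `w` are `d :: w`
  -- with `d ≠ 0`, so there are `r - 1` of them.
  | blob (j : ZMod r) (k : Fin (r / 2)) (f : E) (b : Bool) (w : List (ZMod r)) : Vtx V E r

/-- Edges of the rotation graph of a layered graph. -/
inductive Edg.{w} (E : Type) (r : ℕ) : Type w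
  | spoke (j : ZMod r) : Edg E r
  | left (j : ZMod r) (k : Fin (r / 2)) : Edg E r
  | right (j : ZMod r) (k : Fin (r / 2)) : Edg E r
  | tree (j : ZMod r) (k : Fin (r / 2)) (f : E) : Edg E r
  | stem (j : ZMod r) (k : Fin (r / 2)) (f : E) (b : Bool) (w : List (ZMod r)) : Edg E r
  | cross (j : ZMod r) (k : Fin (r / 2)) (f : E) (t : List (ZMod r)) (a c : ZMod r) : Edg E r
  | clique (j : ZMod r) (k : Fin (r / 2)) (f : E) (t : List (ZMod r)) (p : Sym2 (ZMod r)) : Edg E r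

variable {V E : Type} {r : ℕ} (Γ : Layered V E) (D : ℕ)

/-- The edge `f` leads from its second end to the previous level in the chosen tree. -/
def IsUp (f : E) : Prop := Γ.level (Γ.ends f true) ≠ 0 ∧ Γ.up (Γ.ends f true) = f

/-- The edge `f` is neither the base edge nor a chosen tree edge. -/
def IsFree (f : E) : Prop := f ≠ Γ.base ∧ ¬ Γ.IsUp f

/-- The height of the tree attached to the end `b` of the free edge `f`. -/
def height (f : E) (b : Bool) : ℕ := D + 1 - Γ.level (Γ.ends f b)

/-- The vertex set of the rotation graph. -/
def IsVtx : Vtx.{u} V E r → Prop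
  | .root => True
  | .rim _ => True
  | .orig _ _ _ => True
  | .blob _ _ f b w => Γ.IsFree f ∧ (∀ a ∈ w, a ≠ 0) ∧ w.length ≤ Γ.height D f b

/-- The edge set of the rotation graph. -/
def IsEdg : Edg.{v} E r → Prop
  | .spoke _ => True
  | .left _ _ => True
  | .right _ _ => True
  | .tree _ _ f => Γ.IsUp f
  | .stem _ _ f b w => Γ.IsFree f ∧ (∀ a ∈ w, a ≠ 0) ∧ w.length ≤ Γ.height D f b
  -- Equal levels give trees of equal height; the leaves below the same `t` in the two trees form a
  -- `K_{r-1,r-1}`.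
  | .cross _ _ f t a c => Γ.IsFree f ∧ Γ.level (Γ.ends f false) = Γ.level (Γ.ends f true) ∧
      (∀ a ∈ t, a ≠ 0) ∧ t.length + 1 = Γ.height D f false ∧ a ≠ 0 ∧ c ≠ 0
  -- The tree at the higher end is one step shorter. Its leaf `t`, given the index `0`, and the
  -- leaves `a :: t` of the other tree form a `K_r`.
  | .clique _ _ f t p => Γ.IsFree f ∧ Γ.level (Γ.ends f true) = Γ.level (Γ.ends f false) + 1 ∧
      (∀ a ∈ t, a ≠ 0) ∧ t.length = Γ.height D f true ∧ ¬ p.IsDiag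

/-- The parent of a vertex of an attached tree. -/
def blobParent (j : ZMod r) (k : Fin (r / 2)) (f : E) (b : Bool) : List (ZMod r) → Vtx.{u} V E r
  | [] => .orig j k (Γ.ends f b)
  | _ :: t => .blob j k f b t

/-- The members of the clique indexed by `t`. -/
def cliqueVtx (j : ZMod r) (k : Fin (r / 2)) (f : E) (t : List (ZMod r)) (a : ZMod r) :
    Vtx.{u} V E r :=
  if a = 0 then .blob j k f true t else .blob j k f false (a :: t)

/-- The ends of an edge of the rotation graph. -/
def rotEnds : Edg.{v} E r → Sym2 (Vtx.{u} V E r)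
  | .spoke j => s(.rim j, .root)
  | .left j k => s(.orig j k (Γ.ends Γ.base false), .rim j)
  | .right j k => s(.orig j k (Γ.ends Γ.base true), .rim (j + 1))
  | .tree j k f => s(.orig j k (Γ.ends f true), .orig j k (Γ.ends f false))
  | .stem j k f b w => s(.blob j k f b w, Γ.blobParent j k f b w)
  | .cross j k f t a c => s(.blob j k f false (a :: t), .blob j k f true (c :: t))
  | .clique j k f t p => p.map (cliqueVtx j k f t)

variable {Γ D}

lemma cliqueVtx_injective (j : ZMod r) (k : Fin (r / 2)) (f : E) (t : List (ZMod r)) :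
    Function.Injective (cliqueVtx.{u} (V := V) j k f t) := by
  intro a c h
  unfold cliqueVtx at h
  split_ifs at h <;> simp_all

lemma isVtx_of_mem_rotEnds (hD : ∀ z, Γ.level z ≤ D) {e : Edg.{v} E r} (he : Γ.IsEdg D e)
    {x : Vtx.{u} V E r} (hx : x ∈ Γ.rotEnds e) : Γ.IsVtx D x := by
  cases e with
  | spoke j => simp only [rotEnds, Sym2.mem_iff] at hx; obtain rfl | rfl := hx <;> trivial
  | left j k => simp only [rotEnds, Sym2.mem_iff] at hx; obtain rfl | rfl := hx <;> trivial
  | right j k => simp only [rotEnds, Sym2.mem_iff] at hx; obtain rfl | rfl := hx <;> trivial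
  | tree j k f => simp only [rotEnds, Sym2.mem_iff] at hx; obtain rfl | rfl := hx <;> trivial
  | stem j k f b w =>
    simp only [rotEnds, Sym2.mem_iff] at hx
    obtain rfl | rfl := hx
    · exact he
    · cases w with
      | nil => trivial
      | cons a t =>
        simp only [IsEdg, List.mem_cons, forall_eq_or_imp, List.length_cons] at he
        exact ⟨he.1, he.2.1.2, by omega⟩
  | cross j k f t a c =>
    obtain ⟨h1, h2, h3, h4, h5, h6⟩ := he
    simp only [rotEnds, Sym2.mem_iff] at hx
    unfold height at h4
    obtain rfl | rfl := hx <;> refine ⟨h1, by simpa [*] using h3, ?_⟩ <;> unfold height <;>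
      rw [List.length_cons] <;> omega
  | clique j k f t p =>
    obtain ⟨h1, h2, h3, h4, h5⟩ := he
    have hD' := hD (Γ.ends f true)
    unfold height at h4
    simp only [rotEnds, Sym2.mem_map] at hx
    obtain ⟨a, -, rfl⟩ := hx
    unfold cliqueVtx
    split_ifs with ha
    · exact ⟨h1, h3, by unfold height; omega⟩
    · exact ⟨h1, by simpa [*] using h3, by unfold height; rw [List.length_cons]; omega⟩

variable (Γ D) in
/-- The rotation graph of a layered graph. -/
def rotGraph (hD : ∀ z, Γ.level z ≤ D) (r : ℕ) : Graph (Vtx.{u} V E r) (Edg.{v} E r) where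
  vertexSet := {x | Γ.IsVtx D x}
  edgeSet := {e | Γ.IsEdg D e}
  IsLink e x y := Γ.IsEdg D e ∧ Γ.rotEnds e = s(x, y)
  isLink_symm := fun e _ ↦ ⟨fun x y h ↦ by rwa [Sym2.eq_swap]⟩
  eq_or_eq_of_isLink_of_isLink := by
    rintro f x y z w ⟨-, h1⟩ ⟨-, h2⟩
    rw [h1, Sym2.eq_iff] at h2
    tauto
  left_mem_of_isLink := fun e x y h ↦ isVtx_of_mem_rotEnds hD h.1 (by rw [h.2]; simp)
  edge_mem_iff_exists_isLink := by
    intro e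
    refine ⟨fun h ↦ ?_, fun ⟨x, y, h⟩ ↦ h.1⟩
    obtain ⟨x, y, hxy⟩ : ∃ x y, Γ.rotEnds.{u} e = s(x, y) :=
      (Γ.rotEnds e).ind fun x y ↦ ⟨x, y, rfl⟩
    exact ⟨x, y, h, hxy⟩

/-- The edges of the rotation graph that belong to its spanning tree. -/
def IsTreeEdg : Edg.{v} E r → Prop
  | .cross _ _ _ _ _ _ => False
  | .clique _ _ _ _ _ => False
  | _ => True

variable (Γ D) in
/-- The spanning tree of the rotation graph. -/
def rotTree (hD : ∀ z, Γ.level z ≤ D) (r : ℕ) : Graph (Vtx.{u} V E r) (Edg.{v} E r) :=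
  (Γ.rotGraph D hD r).restrict {e | IsTreeEdg e}

variable (Γ) in
/-- Distance from the root in the spanning tree. -/
def depth : Vtx.{u} V E r → ℕ
  | .root => 0
  | .rim _ => 1
  | .orig _ _ z => Γ.level z + 2
  | .blob _ _ f b w => Γ.level (Γ.ends f b) + 3 + w.length

open scoped Classical in
variable (Γ) in
/-- The parent of a vertex in the spanning tree. -/
noncomputable def parent : Vtx.{u} V E r → Vtx.{u} V E r
  | .root => .root
  | .rim _ => .root
  | .orig j k z => if Γ.level z ≠ 0 then .orig j k (Γ.ends (Γ.up z) false)
      else if z = Γ.ends Γ.base false then .rim j else .rim (j + 1)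
  | .blob j k f b w => Γ.blobParent j k f b w

open scoped Classical in
variable (Γ) in
/-- The edge from a vertex to its parent in the spanning tree. -/
noncomputable def parentEdge : Vtx.{u} V E r → Edg.{v} E r
  | .root => .spoke 0
  | .rim j => .spoke j
  | .orig j k z => if Γ.level z ≠ 0 then .tree j k (Γ.up z)
      else if z = Γ.ends Γ.base false then .left j k else .right j k
  | .blob j k f b w => .stem j k f b w

lemma isUp_up {z : V} (hz : Γ.level z ≠ 0) : Γ.IsUp (Γ.up z) := by
  have := Γ.ends_up z hz
  exact ⟨by rwa [this], by rw [this]⟩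

lemma rotTree_isLink {hD : ∀ z, Γ.level z ≤ D} {e : Edg.{v} E r} {x y : Vtx.{u} V E r} :
    (Γ.rotTree D hD r).IsLink e x y ↔ (Γ.IsEdg D e ∧ Γ.rotEnds e = s(x, y)) ∧ IsTreeEdg e := by
  simp only [rotTree, restrict_isLink, Set.mem_ofPred_eq]
  rw [and_comm]
  rfl

/-- With the base edge absent, the level structure of each copy hangs from its two rim vertices, and
each attached tree hangs from its end of `f`. `rotEnds` lists the child first for every tree edge,
which is why `key` is applied with `rfl`. -/
lemma rotTree_isParentTree (hD : ∀ z, Γ.level z ≤ D) :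
    (Γ.rotTree.{u, v} D hD r).IsParentTree .root Γ.parent Γ.parentEdge Γ.depth := by
  refine ⟨trivial, rfl, ?_, ?_, ?_⟩
  · intro x hx hxr
    rw [rotTree_isLink]
    cases x with
    | root => exact absurd rfl hxr
    | rim j => exact ⟨⟨trivial, rfl⟩, trivial⟩
    | orig j k z =>
      simp only [parent, parentEdge]
      split_ifs with h1 h2
      · exact ⟨⟨isUp_up h1, by simp only [rotEnds, Γ.ends_up z h1]⟩, trivial⟩
      · exact ⟨⟨trivial, by simp only [rotEnds, h2]⟩, trivial⟩
      · have h3 := (Γ.eq_of_level z (not_not.1 h1)).resolve_left h2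
        exact ⟨⟨trivial, by simp only [rotEnds, h3]⟩, trivial⟩
    | blob j k f b w => exact ⟨⟨hx, rfl⟩, trivial⟩
  · intro x hx hxr
    cases x with
    | root => exact absurd rfl hxr
    | rim j => rfl
    | orig j k z =>
      simp only [parent]
      split_ifs with h1 h2
      · have := Γ.level_up z h1
        simp only [depth]; omega
      · simp only [depth]; omega
      · simp only [depth]; omega
    | blob j k f b w =>
      cases w with
      | nil => simp [parent, depth, blobParent]
      | cons a t => simp [parent, depth, blobParent]; omega
  · intro e x y h
    rw [rotTree_isLink] at h
    obtain ⟨⟨h1, h2⟩, h3⟩ := h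
    have key : ∀ x' y' : Vtx.{u} V E r, Γ.rotEnds e = s(x', y') →
        (x' ≠ .root ∧ e = Γ.parentEdge x' ∧ y' = Γ.parent x') →
        (x ≠ .root ∧ e = Γ.parentEdge x ∧ y = Γ.parent x) ∨
          (y ≠ .root ∧ e = Γ.parentEdge y ∧ x = Γ.parent y) := by
      intro x' y' h4 h5
      rw [h4, Sym2.eq_iff] at h2
      obtain ⟨rfl, rfl⟩ | ⟨rfl, rfl⟩ := h2
      · exact .inl h5
      · exact .inr h5
    cases e with
    | spoke j => exact key _ _ rfl ⟨by simp, rfl, rfl⟩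
    | left j k =>
      refine key _ _ rfl ⟨by simp, ?_, ?_⟩
      · simp [parentEdge, Γ.level_base]
      · simp [parent, Γ.level_base]
    | right j k =>
      refine key _ _ rfl ⟨by simp, ?_, ?_⟩
      · simp [parentEdge, Γ.level_base, (Γ.ends_ne Γ.base).symm]
      · simp [parent, Γ.level_base, (Γ.ends_ne Γ.base).symm]
    | tree j k f =>
      obtain ⟨h5, h6⟩ := h1
      refine key _ _ rfl ⟨by simp, ?_, ?_⟩
      · simp [parentEdge, h5, h6]
      · simp [parent, h5, h6]
    | stem j k f b w => exact key _ _ rfl ⟨by simp, rfl, rfl⟩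
    | cross => exact h3.elim
    | clique => exact h3.elim

lemma rotTree_isSpanningSubgraph (hD : ∀ z, Γ.level z ≤ D) :
    Γ.rotTree.{u, v} D hD r ≤s Γ.rotGraph D hD r :=
  ⟨restrict_le, rfl⟩

/-- An edge outside the spanning tree joins two distinct leaves of the spanning tree. -/
lemma depth_eq_of_not_isTreeEdg (hD : ∀ z, Γ.level z ≤ D) {e : Edg.{v} E r}
    (he : Γ.IsEdg D e) (ht : ¬ IsTreeEdg e) {x : Vtx.{u} V E r} (hx : x ∈ Γ.rotEnds e) :
    Γ.depth x = D + 4 := by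
  cases e with
  | spoke | left | right | tree | stem => exact absurd trivial ht
  | cross j k f t a c =>
    obtain ⟨h1, h2, h3, h4, h5, h6⟩ := he
    have := hD (Γ.ends f true)
    simp only [rotEnds, Sym2.mem_iff] at hx
    unfold height at h4
    obtain rfl | rfl := hx <;> simp only [depth, List.length_cons] <;> omega
  | clique j k f t p =>
    obtain ⟨h1, h2, h3, h4, h5⟩ := he
    have hD' := hD (Γ.ends f true)
    unfold height at h4
    simp only [rotEnds, Sym2.mem_map] at hx
    obtain ⟨a, -, rfl⟩ := hx
    unfold cliqueVtx
    split_ifs with ha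
    · simp only [depth]; omega
    · simp only [depth, List.length_cons]; omega

/-- Tree edges change depth by one while the others stay at depth `D + 4`, so the two kinds are
never parallel. Among the others, `cross` and `clique` belong to edges `f` with different level
patterns, and within each kind the ends determine the edge. -/
lemma rotGraph_simple (hD : ∀ z, Γ.level z ≤ D) : (Γ.rotGraph.{u, v} D hD r).Simple := by
  have hT := rotTree_isParentTree.{u, v} (r := r) hD
  have hTs := hT.simple
  have htree : ∀ e x y, (Γ.rotGraph.{u, v} D hD r).IsLink e x y → IsTreeEdg e →
      (Γ.rotTree.{u, v} D hD r).IsLink e x y := fun e x y h h' ↦ rotTree_isLink.2 ⟨h, h'⟩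
  have hmix : ∀ e f x y, (Γ.rotGraph.{u, v} D hD r).IsLink e x y →
      (Γ.rotGraph.{u, v} D hD r).IsLink f x y → IsTreeEdg e → ¬ IsTreeEdg f → False := by
    intro e f x y he hf h1 h2
    have h3 := depth_eq_of_not_isTreeEdg.{u} hD hf.1 h2 (x := x) (by rw [hf.2]; simp)
    have h4 := depth_eq_of_not_isTreeEdg.{u} hD hf.1 h2 (x := y) (by rw [hf.2]; simp)
    have h5 := hT.depth_isLink (htree _ _ _ he h1)
    omega
  refine { not_isLoopAt := ?_, eq_of_isLink := ?_ }
  · intro e x h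
    by_cases ht : IsTreeEdg e
    · exact hTs.not_isLoopAt e x (htree _ _ _ h ht)
    · obtain ⟨h1, h2⟩ := h
      cases e with
      | spoke | left | right | tree | stem => exact ht trivial
      | cross j k f t a c =>
        simp only [rotEnds, Sym2.eq_iff] at h2
        grind
      | clique j k f t p =>
        induction p using Sym2.ind with
        | _ a c =>
          simp only [rotEnds, Sym2.map_mk, Sym2.eq_iff] at h2
          refine h1.2.2.2.2 (cliqueVtx_injective.{u} (V := V) j k f t ?_)
          grind
  · intro e e' x y h h'
    by_cases ht : IsTreeEdg e <;> by_cases ht' : IsTreeEdg e'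
    · exact hTs.eq_of_isLink (htree _ _ _ h ht) (htree _ _ _ h' ht')
    · exact (hmix _ _ _ _ h h' ht ht').elim
    · exact (hmix _ _ _ _ h' h ht' ht).elim
    · obtain ⟨h1, h2⟩ := h
      obtain ⟨h1', h2'⟩ := h'
      rw [← h2'] at h2
      cases e with
      | spoke | left | right | tree | stem => exact absurd trivial ht
      | cross j k f t a c =>
        cases e' with
        | spoke | left | right | tree | stem => exact absurd trivial ht'
        | cross j' k' f' t' a' c' =>
          simp only [rotEnds, Sym2.eq_iff] at h2
          grind
        | clique j' k' f' t' p =>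
          have h3 := h1.2.1
          have h4 := h1'.2.1
          induction p using Sym2.ind with
          | _ a' c' =>
            simp only [rotEnds, Sym2.map_mk, Sym2.eq_iff, cliqueVtx] at h2
            grind
      | clique j k f t p =>
        cases e' with
        | spoke | left | right | tree | stem => exact absurd trivial ht'
        | cross j' k' f' t' a' c' =>
          have h3 := h1.2.1
          have h4 := h1'.2.1
          induction p using Sym2.ind with
          | _ a c =>
            simp only [rotEnds, Sym2.map_mk, Sym2.eq_iff, cliqueVtx] at h2
            grind
        | clique j' k' f' t' p' =>
          have h3 : j = j' ∧ k = k' ∧ f = f' ∧ t = t' := by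
            have h5 := h1.2.2.2.2
            have h6 := h1'.2.2.2.2
            induction p using Sym2.ind with
            | _ a c =>
              induction p' using Sym2.ind with
              | _ a' c' =>
                simp only [rotEnds, Sym2.map_mk, Sym2.eq_iff, cliqueVtx] at h2
                rw [Sym2.mk_isDiag_iff] at h5 h6
                grind
          obtain ⟨rfl, rfl, rfl, rfl⟩ := h3
          rw [Sym2.map.injective (cliqueVtx_injective.{u} (V := V) j k f t) h2]

end Layered

end Graph

/-! ### The rotation, and leaves of the spanning tree. -/

namespace Graph

namespace Layered

variable {V E : Type} {r : ℕ} {Γ : Layered V E} {D : ℕ}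

/-- Rotation of the vertices by `c`. -/
def rotVtx (c : ZMod r) : Vtx.{u} V E r → Vtx.{u} V E r
  | .root => .root
  | .rim j => .rim (j + c)
  | .orig j k z => .orig (j + c) k z
  | .blob j k f b w => .blob (j + c) k f b w

/-- Rotation of the edges by `c`. -/
def rotEdg (c : ZMod r) : Edg.{v} E r → Edg.{v} E r
  | .spoke j => .spoke (j + c)
  | .left j k => .left (j + c) k
  | .right j k => .right (j + c) k
  | .tree j k f => .tree (j + c) k f
  | .stem j k f b w => .stem (j + c) k f b w
  | .cross j k f t a d => .cross (j + c) k f t a d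
  | .clique j k f t p => .clique (j + c) k f t p

lemma rotVtx_add (c d : ZMod r) (x : Vtx.{u} V E r) :
    rotVtx d (rotVtx c x) = rotVtx (c + d) x := by
  cases x <;> simp [rotVtx, add_assoc]

lemma rotEdg_add (c d : ZMod r) (e : Edg.{v} E r) :
    rotEdg d (rotEdg c e) = rotEdg (c + d) e := by
  cases e <;> simp [rotEdg, add_assoc]

lemma rotVtx_zero (x : Vtx.{u} V E r) : rotVtx 0 x = x := by
  cases x <;> simp [rotVtx]

lemma rotEdg_zero (e : Edg.{v} E r) : rotEdg 0 e = e := by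
  cases e <;> simp [rotEdg]

/-- Rotation as a permutation of the vertices. -/
def rotVtxEquiv (c : ZMod r) : Vtx.{u} V E r ≃ Vtx.{u} V E r where
  toFun := rotVtx c
  invFun := rotVtx (-c)
  left_inv x := by rw [rotVtx_add, add_neg_cancel, rotVtx_zero]
  right_inv x := by rw [rotVtx_add, neg_add_cancel, rotVtx_zero]

/-- Rotation as a permutation of the edges. -/
def rotEdgEquiv (c : ZMod r) : Edg.{v} E r ≃ Edg.{v} E r where
  toFun := rotEdg c
  invFun := rotEdg (-c)
  left_inv x := by rw [rotEdg_add, add_neg_cancel, rotEdg_zero]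
  right_inv x := by rw [rotEdg_add, neg_add_cancel, rotEdg_zero]

lemma isVtx_rotVtx (c : ZMod r) (x : Vtx.{u} V E r) : Γ.IsVtx D (rotVtx c x) ↔ Γ.IsVtx D x := by
  cases x <;> rfl

lemma isEdg_rotEdg (c : ZMod r) (e : Edg.{v} E r) : Γ.IsEdg D (rotEdg c e) ↔ Γ.IsEdg D e := by
  cases e <;> rfl

lemma isTreeEdg_rotEdg (c : ZMod r) (e : Edg.{v} E r) : IsTreeEdg (rotEdg c e) ↔ IsTreeEdg e := by
  cases e <;> rfl

lemma rotEnds_rotEdg (c : ZMod r) (e : Edg.{v} E r) :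
    Γ.rotEnds.{u} (rotEdg c e) = (Γ.rotEnds e).map (rotVtx c) := by
  cases e with
  | right j k => simp [rotEdg, rotEnds, rotVtx, add_right_comm]
  | stem j k f b w => cases w <;> simp [rotEdg, rotEnds, rotVtx, blobParent]
  | clique j k f t p =>
    simp only [rotEdg, rotEnds, Sym2.map_map]
    congr 1
    ext a
    simp only [cliqueVtx, Function.comp]
    split_ifs <;> rfl
  | _ => simp [rotEdg, rotEnds, rotVtx]

lemma rotGraph_isLink_rot (hD : ∀ z, Γ.level z ≤ D) (c : ZMod r) (e : Edg.{v} E r)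
    (x y : Vtx.{u} V E r) :
    (Γ.rotGraph D hD r).IsLink (rotEdg c e) (rotVtx c x) (rotVtx c y) ↔
      (Γ.rotGraph D hD r).IsLink e x y := by
  change Γ.IsEdg D _ ∧ _ ↔ Γ.IsEdg D _ ∧ _
  have hinj : Function.Injective (rotVtx.{u} (V := V) (E := E) c) := (rotVtxEquiv c).injective
  rw [isEdg_rotEdg, rotEnds_rotEdg, ← Sym2.map_mk, (Sym2.map.injective hinj).eq_iff]

lemma rotGraph_isAutomorphism (hD : ∀ z, Γ.level z ≤ D) :
    (Γ.rotGraph.{u, v} D hD r).IsAutomorphism (rotVtx 1) :=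
  isAutomorphism_of_equiv (rotVtxEquiv 1) (rotEdgEquiv 1) (isVtx_rotVtx 1)
    (rotGraph_isLink_rot hD 1)

lemma rotTree_isAutomorphism (hD : ∀ z, Γ.level z ≤ D) :
    (Γ.rotTree.{u, v} D hD r).IsAutomorphism (rotVtx 1) := by
  refine isAutomorphism_of_equiv (rotVtxEquiv 1) (rotEdgEquiv 1) (isVtx_rotVtx 1) fun e x y ↦ ?_
  have h := rotGraph_isLink_rot hD 1 e x y
  rw [rotTree_isLink, rotTree_isLink]
  exact and_congr h (isTreeEdg_rotEdg 1 e)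

lemma iterate_rotVtx (n : ℕ) (x : Vtx.{u} V E r) : (rotVtx 1)^[n] x = rotVtx (n : ZMod r) x := by
  induction n with
  | zero => simp [rotVtx_zero]
  | succ n ih => rw [Function.iterate_succ_apply', ih, rotVtx_add]; simp

/-- Every vertex but the root has a coordinate in `ZMod r` that is shifted by one. -/
lemma minimalPeriod_rotVtx {x : Vtx.{u} V E r} (hx : x ≠ .root) :
    Function.minimalPeriod (rotVtx 1) x = r := by
  have key : ∀ n : ℕ, Function.IsPeriodicPt (rotVtx 1) n x ↔ r ∣ n := by
    intro n
    rw [Function.IsPeriodicPt, Function.IsFixedPt, iterate_rotVtx, ← ZMod.natCast_eq_zero_iff]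
    cases x with
    | root => exact absurd rfl hx
    | _ => simp [rotVtx]
  refine Nat.dvd_antisymm ?_ ((key _).1 (Function.isPeriodicPt_minimalPeriod _ _))
  exact ((key r).2 dvd_rfl).minimalPeriod_dvd

lemma mem_edgeBoundary_singleton (hD : ∀ z, Γ.level z ≤ D) {e : Edg.{v} E r}
    {x : Vtx.{u} V E r} :
    e ∈ (Γ.rotGraph D hD r).edgeBoundary {x} ↔ Γ.IsEdg D e ∧ x ∈ Γ.rotEnds e := by
  have := rotGraph_simple.{u, v} (r := r) hD
  constructor
  · rintro ⟨y, z, ⟨h1, h2⟩, rfl, -⟩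
    exact ⟨h1, by rw [h2]; simp⟩
  · rintro ⟨h1, h2⟩
    obtain ⟨y, hy⟩ := h2
    have hl : (Γ.rotGraph D hD r).IsLink e x y := ⟨h1, hy⟩
    exact ⟨x, y, hl, rfl, hl.ne.symm⟩

/-- Words have length at most `D + 1 - level`, so they end at depth at most `level + 3 + (D + 1 -
level) = D + 4`; all other vertices are less deep. -/
lemma depth_le (hD : ∀ z, Γ.level z ≤ D) {x : Vtx.{u} V E r} (hx : Γ.IsVtx D x) :
    Γ.depth x ≤ D + 4 := by
  cases x with
  | root => simp [depth]
  | rim j => simp [depth]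
  | orig j k z => have := hD z; simp only [depth]; omega
  | blob j k f b w =>
    have h1 := hx.2.2
    have := hD (Γ.ends f b)
    unfold height at h1
    simp only [depth]
    omega

lemma edgeBoundary_rotTree (hD : ∀ z, Γ.level z ≤ D) (X : Set (Vtx.{u} V E r)) :
    (Γ.rotTree.{u, v} D hD r).edgeBoundary X =
      (Γ.rotGraph D hD r).edgeBoundary X ∩ {e | IsTreeEdg e} := by
  ext e
  simp only [edgeBoundary, Set.mem_ofPred_eq, Set.mem_inter_iff, rotTree_isLink]
  constructor
  · rintro ⟨x, y, ⟨h1, h2⟩, h3⟩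
    exact ⟨⟨x, y, h1, h3⟩, h2⟩
  · rintro ⟨⟨x, y, h1, h3⟩, h2⟩
    exact ⟨x, y, ⟨h1, h2⟩, h3⟩

/-- Leaves of the spanning tree are the vertices of depth `D + 4`. -/
lemma deg_rotTree_of_depth_eq (hD : ∀ z, Γ.level z ≤ D) {x : Vtx.{u} V E r} (hx : Γ.IsVtx D x)
    (hd : Γ.depth x = D + 4) : (Γ.rotTree.{u, v} D hD r).deg x = 1 := by
  have hT := rotTree_isParentTree.{u, v} (r := r) hD
  have hs := hT.simple
  have hxr : x ≠ .root := by rintro rfl; simp [depth] at hd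
  rw [deg_eq_ncard_edgeBoundary, Set.ncard_eq_one]
  refine ⟨Γ.parentEdge x, Set.eq_singleton_iff_unique_mem.2 ⟨?_, ?_⟩⟩
  · have hl := hT.isLink_parent x hx hxr
    exact hl.mem_edgeBoundary_iff.2 (.inl ⟨rfl, hl.ne.symm⟩)
  · rintro e ⟨x', y, hl, rfl, hy⟩
    obtain ⟨h1, h2, h3⟩ | ⟨h1, h2, h3⟩ := hT.eq_of_isLink e _ y hl
    · exact h2
    · have h4 := hT.depth_parent y hl.right_mem h1
      have h5 := depth_le hD (x := y) hl.right_mem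
      rw [← h3] at h4
      omega

/-- Edges outside the tree only occur at depth `D + 4`, so elsewhere the tree contains all edges at
`x`. -/
lemma deg_rotTree_of_depth_ne (hD : ∀ z, Γ.level z ≤ D) {x : Vtx.{u} V E r}
    (hd : Γ.depth x ≠ D + 4) :
    (Γ.rotTree.{u, v} D hD r).deg x = ((Γ.rotGraph.{u, v} D hD r).edgeBoundary {x}).ncard := by
  have hT := rotTree_isParentTree.{u, v} (r := r) hD
  have hs := hT.simple
  rw [deg_eq_ncard_edgeBoundary, edgeBoundary_rotTree]
  congr 1
  refine Set.inter_eq_left.2 fun e he ↦ ?_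
  rw [mem_edgeBoundary_singleton] at he
  by_contra h
  exact hd (depth_eq_of_not_isTreeEdg hD he.1 h he.2)

lemma rotGraph_isConnected (hD : ∀ z, Γ.level z ≤ D) : (Γ.rotGraph.{u, v} D hD r).IsConnected :=
  (rotTree_isParentTree hD).isConnected.mono (rotTree_isSpanningSubgraph hD)

/-- The leaves are exactly the vertices of depth `D + 4`: all others have degree `r` in the tree,
and `1 < r` keeps this apart from degree one. -/
lemma rotGraph_isRotationRGraph (hD : ∀ z, Γ.level z ≤ D) (hr : 1 < r)
    (hG : (Γ.rotGraph.{u, v} D hD r).IsRGraph r) :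
    (Γ.rotGraph.{u, v} D hD r).IsRotationRGraph r := by
  have hT := rotTree_isParentTree.{u, v} (r := r) hD
  have hroot : (Γ.rotTree.{u, v} D hD r).deg .root = r := by
    rw [deg_rotTree_of_depth_ne hD (by simp [depth]),
      hG.ncard_edgeBoundary_singleton hT.root_mem]
  refine ⟨hG, D + 4, Γ.rotTree D hD r, ⟨.root, hT.root_mem⟩, rotVtx 1,
    rotTree_isSpanningSubgraph hD, ⟨hT.isTree hG.finite_vertexSet, fun x ↦ ?_, hroot, ?_⟩,
    rotGraph_isAutomorphism hD, rotTree_isAutomorphism hD, ?_, fun x hx hxr ↦ ?_⟩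
  · by_cases h : Γ.depth x.1 = D + 4
    · exact .inl (deg_rotTree_of_depth_eq hD x.2 h)
    · right
      rw [deg_rotTree_of_depth_ne hD h, hG.ncard_edgeBoundary_singleton x.2]
  · intro x hx hd
    rw [hT.dist_eq]
    by_contra h
    rw [deg_rotTree_of_depth_ne hD h, hG.ncard_edgeBoundary_singleton x.2] at hd
    omega
  · exact Function.minimalPeriod_eq_one_iff_isFixedPt.2 rfl
  · rw [hroot, minimalPeriod_rotVtx hxr]

end Layered

end Graph

/-! ### Regularity, the colouring of tree pairs, and the two-edge cuts. -/

namespace Graph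

namespace Layered

variable {V E : Type} {r : ℕ} {Γ : Layered V E} {D : ℕ}

variable (Γ D) in
/-- An enumeration of the edges at a vertex of an attached tree. -/
def edgeAt (j : ZMod r) (k : Fin (r / 2)) (f : E) (b : Bool) (w : List (ZMod r)) (d : ZMod r) :
    Edg.{v} E r :=
  if d = 0 then .stem j k f b w
  else if w.length < Γ.height D f b then .stem j k f b (d :: w)
  else if Γ.level (Γ.ends f false) = Γ.level (Γ.ends f true) then
    bif b then .cross j k f w.tail d (w.headD 0) else .cross j k f w.tail (w.headD 0) d
  -- In a clique, `d` is the difference between the index of the other member and that of the given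
  -- one.
  else bif b then .clique j k f w s(0, d) else .clique j k f w.tail s(w.headD 0, w.headD 0 + d)

/-- An edge colouring that is proper at the vertices of attached trees. -/
def colour : Edg.{v} E r → ZMod r
  | .stem _ _ _ _ w => 2 * w.sum
  | .cross _ _ _ t a c => 2 * t.sum + 2 * a + 2 * c
  | .clique _ _ _ t p => 2 * t.sum + Sym2.lift ⟨fun a c ↦ a + c, add_comm⟩ p
  | _ => 0

lemma exists_eq_edgeAt (hD : ∀ z, Γ.level z ≤ D) {j : ZMod r} {k : Fin (r / 2)} {f : E} {b : Bool}
    {w : List (ZMod r)} {e : Edg.{v} E r} (he : Γ.IsEdg D e)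
    (hx : (.blob j k f b w : Vtx.{u} V E r) ∈ Γ.rotEnds e) :
    ∃ d, e = Γ.edgeAt D j k f b w d := by
  cases e with
  | spoke | left | right | tree => simp [rotEnds] at hx
  | stem j' k' f' b' w' =>
    simp only [rotEnds, Sym2.mem_iff] at hx
    obtain hx | hx := hx
    · injection hx with h1 h2 h3 h4 h5
      subst h1 h2 h3 h4 h5
      exact ⟨0, by simp [edgeAt]⟩
    · cases w' with
      | nil => simp [blobParent] at hx
      | cons a t =>
        simp only [blobParent] at hx
        injection hx with h1 h2 h3 h4 h5
        subst h1 h2 h3 h4 h5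
        obtain ⟨h1, h2, h3⟩ := he
        have ha : a ≠ 0 := h2 a (by simp)
        rw [List.length_cons] at h3
        refine ⟨a, ?_⟩
        rw [edgeAt, if_neg ha, if_pos (by omega)]
  | cross j' k' f' t a c =>
    obtain ⟨h1, h2, h3, h4, h5, h6⟩ := he
    have h7 : Γ.height D f' true = Γ.height D f' false := by rw [height, height, h2]
    simp only [rotEnds, Sym2.mem_iff] at hx
    obtain hx | hx := hx
    · injection hx with g1 g2 g3 g4 g5
      subst g1 g2 g3 g4 g5
      refine ⟨c, ?_⟩
      rw [edgeAt, if_neg h6, if_neg (by rw [List.length_cons]; omega), if_pos h2]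
      rfl
    · injection hx with g1 g2 g3 g4 g5
      subst g1 g2 g3 g4 g5
      refine ⟨a, ?_⟩
      rw [edgeAt, if_neg h5, if_neg (by rw [List.length_cons]; omega), if_pos h2]
      rfl
  | clique j' k' f' t p =>
    obtain ⟨h1, h2, h3, h4, h5⟩ := he
    have h7 : Γ.height D f' true + 1 = Γ.height D f' false := by
      have := hD (Γ.ends f' true)
      rw [height, height]; omega
    simp only [rotEnds, Sym2.mem_map] at hx
    obtain ⟨a, ⟨c, rfl⟩, hx⟩ := hx
    have hac : a ≠ c := h5
    unfold cliqueVtx at hx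
    split_ifs at hx with ha
    · subst ha
      injection hx with g1 g2 g3 g4 g5
      subst g1 g2 g3 g4 g5
      refine ⟨c, ?_⟩
      rw [edgeAt, if_neg hac.symm, if_neg (by omega), if_neg (by omega)]
      rfl
    · injection hx with g1 g2 g3 g4 g5
      subst g1 g2 g3 g4 g5
      refine ⟨c - a, ?_⟩
      rw [edgeAt, if_neg (sub_ne_zero.2 hac.symm), if_neg (by rw [List.length_cons]; omega),
        if_neg (by omega)]
      simp

lemma edgeAt_mem (hD : ∀ z, Γ.level z ≤ D) {j : ZMod r} {k : Fin (r / 2)} {f : E} {b : Bool}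
    {w : List (ZMod r)} (hx : Γ.IsVtx D (.blob j k f b w : Vtx.{u} V E r)) (d : ZMod r) :
    Γ.IsEdg D (Γ.edgeAt.{v} D j k f b w d) ∧
      (.blob j k f b w : Vtx.{u} V E r) ∈ Γ.rotEnds (Γ.edgeAt.{v} D j k f b w d) := by
  obtain ⟨h1, h2, h3⟩ := hx
  have hle := Γ.level_le f
  have hle' := Γ.le_level f
  have hDf := hD (Γ.ends f true)
  unfold edgeAt
  split_ifs with hd hw heq
  · exact ⟨⟨h1, h2, h3⟩, by simp [rotEnds]⟩
  · exact ⟨⟨h1, by simpa [hd] using h2, by rw [List.length_cons]; omega⟩,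
      by simp [rotEnds, blobParent]⟩
  · have hh : Γ.height D f true = Γ.height D f false := by rw [height, height, heq]
    -- Levels are at most `D`, so a word of maximal length has a head to split off.
    have hpos : 0 < Γ.height D f false := by rw [height]; omega
    cases w with
    | nil => cases b <;> simp at hw <;> omega
    | cons a t =>
      simp only [List.mem_cons, forall_eq_or_imp, List.length_cons] at h2 h3 hw
      cases b
      · exact ⟨⟨h1, heq, h2.2, by rw [List.tail_cons]; omega, h2.1, hd⟩, by simp [rotEnds]⟩
      · exact ⟨⟨h1, heq, h2.2, by rw [List.tail_cons]; omega, hd, h2.1⟩, by simp [rotEnds]⟩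
  · have hh : Γ.height D f true + 1 = Γ.height D f false := by rw [height, height]; omega
    cases b
    · cases w with
      | nil => simp at hw; omega
      | cons a t =>
        simp only [List.mem_cons, forall_eq_or_imp, List.length_cons] at h2 h3 hw
        refine ⟨⟨h1, by omega, h2.2, by simp only [List.tail_cons]; omega, ?_⟩, ?_⟩
        · simp [Sym2.mk_isDiag_iff, hd]
        · simp [rotEnds, cliqueVtx, h2.1]
    · refine ⟨⟨h1, by omega, h2, by omega, ?_⟩, ?_⟩
      · simpa [Sym2.mk_isDiag_iff] using Ne.symm hd
      · simp [rotEnds, cliqueVtx]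

lemma edgeBoundary_blob (hD : ∀ z, Γ.level z ≤ D) {j : ZMod r} {k : Fin (r / 2)} {f : E}
    {b : Bool} {w : List (ZMod r)} (hx : Γ.IsVtx D (.blob j k f b w : Vtx.{u} V E r)) :
    (Γ.rotGraph.{u, v} D hD r).edgeBoundary {.blob j k f b w} =
      Set.range (Γ.edgeAt D j k f b w) := by
  ext e
  rw [mem_edgeBoundary_singleton]
  constructor
  · rintro ⟨h1, h2⟩
    obtain ⟨d, hd⟩ := exists_eq_edgeAt hD h1 h2
    exact ⟨d, hd.symm⟩
  · rintro ⟨d, rfl⟩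
    exact edgeAt_mem hD hx d

/-- At a vertex `w` the stem has colour `2 * w.sum`, and the formulas for the other kinds of edges
are chosen to continue this affinely in `d`. The slope is `1` at clique vertices and `2` elsewhere.
-/
lemma colour_edgeAt (hD : ∀ z, Γ.level z ≤ D) {j : ZMod r} {k : Fin (r / 2)} {f : E}
    {b : Bool} {w : List (ZMod r)} (hx : Γ.IsVtx D (.blob j k f b w : Vtx.{u} V E r)) :
    (∀ d, colour (Γ.edgeAt.{v} D j k f b w d) = 2 * w.sum + 2 * d) ∨
      ∀ d, colour (Γ.edgeAt.{v} D j k f b w d) = 2 * w.sum + d := by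
  obtain ⟨h1, h2, h3⟩ := hx
  have hle := Γ.level_le f
  have hle' := Γ.le_level f
  have hDf := hD (Γ.ends f true)
  by_cases hw : w.length < Γ.height D f b
  · left
    intro d
    by_cases hd : d = 0
    · subst hd; simp [edgeAt, colour]
    · simp only [edgeAt, hd, hw, if_true, if_false, colour, List.sum_cons]
      ring
  by_cases heq : Γ.level (Γ.ends f false) = Γ.level (Γ.ends f true)
  · left
    intro d
    by_cases hd : d = 0
    · subst hd; simp [edgeAt, colour]
    have hh : Γ.height D f true = Γ.height D f false := by rw [height, height, heq]
    have hpos : 0 < Γ.height D f false := by rw [height]; omega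
    cases w with
    | nil => cases b <;> simp at hw <;> omega
    | cons a t =>
      cases b <;> simp only [edgeAt, hd, hw, heq, if_true, if_false, cond_true, cond_false, colour,
        List.sum_cons, List.tail_cons, List.headD_cons] <;> ring
  · right
    intro d
    by_cases hd : d = 0
    · subst hd; simp [edgeAt, colour]
    have hh : Γ.height D f true + 1 = Γ.height D f false := by rw [height, height]; omega
    cases b
    · cases w with
      | nil => simp at hw; omega
      | cons a t =>
        simp only [edgeAt, hd, hw, heq, if_false, cond_false, colour,
          List.sum_cons, List.tail_cons, List.headD_cons, Sym2.lift_mk]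
        ring
    · simp only [edgeAt, hd, hw, heq, if_false, cond_true, colour, Sym2.lift_mk]
      ring

/-- An affine map of slope `1` or `2` is injective on `ZMod r` because `r` is odd. -/
lemma colour_edgeAt_bijective (hr : Odd r) (hD : ∀ z, Γ.level z ≤ D) {j : ZMod r}
    {k : Fin (r / 2)} {f : E} {b : Bool} {w : List (ZMod r)}
    (hx : Γ.IsVtx D (.blob j k f b w : Vtx.{u} V E r)) :
    Function.Bijective fun d ↦ colour (Γ.edgeAt.{v} D j k f b w d) := by
  have : NeZero r := ⟨by rintro rfl; simp at hr⟩
  refine Finite.injective_iff_bijective.1 fun d d' (h : colour _ = colour _) ↦ ?_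
  obtain hc | hc := colour_edgeAt.{u, v} hD hx <;>
    rw [hc, hc, add_right_inj] at h
  · rw [← sub_eq_zero, ← mul_sub, two_mul, ZMod.add_self_eq_zero_iff_eq_zero hr, sub_eq_zero] at h
    exact h
  · exact h

lemma ncard_range_of_injective {ι κ : Type*} {g : ι → κ} (hg : Function.Injective g) :
    (Set.range g).ncard = Nat.card ι := by
  rw [← Set.image_univ, Set.ncard_image_of_injective _ hg, Set.ncard_univ]

lemma ncard_edgeBoundary_blob (hr : Odd r) (hD : ∀ z, Γ.level z ≤ D) {j : ZMod r}
    {k : Fin (r / 2)} {f : E} {b : Bool} {w : List (ZMod r)}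
    (hx : Γ.IsVtx D (.blob j k f b w : Vtx.{u} V E r)) :
    ((Γ.rotGraph.{u, v} D hD r).edgeBoundary {.blob j k f b w}).ncard = r := by
  rw [edgeBoundary_blob hD hx, ncard_range_of_injective, Nat.card_zmod]
  exact Function.Injective.of_comp (f := colour)
    (colour_edgeAt_bijective.{u, v} hr hD hx).injective

/-- The vertex belongs to the tree pair attached to the copy of `f` with index `j`, `k`. -/
def InBlob (j : ZMod r) (k : Fin (r / 2)) (f : E) : Vtx.{u} V E r → Prop
  | .blob j' k' f' _ _ => j' = j ∧ k' = k ∧ f' = f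
  | _ => False

/-- The vertex belongs to the copy of the layered graph with index `j`, `k`. -/
def InCopy (j : ZMod r) (k : Fin (r / 2)) : Vtx.{u} V E r → Prop
  | .orig j' k' _ => j' = j ∧ k' = k
  | .blob j' k' _ _ _ => j' = j ∧ k' = k
  | _ => False

variable (Γ D) in
/-- The vertices of the tree pair attached to the copy of `f` with index `j`, `k`. -/
def blobSet (j : ZMod r) (k : Fin (r / 2)) (f : E) : Set (Vtx.{u} V E r) :=
  {x | Γ.IsVtx D x ∧ InBlob j k f x}

variable (Γ D) in
/-- The vertices of the copy of the layered graph with index `j`, `k`. -/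
def copySet (j : ZMod r) (k : Fin (r / 2)) : Set (Vtx.{u} V E r) :=
  {x | Γ.IsVtx D x ∧ InCopy j k x}

lemma mem_edgeBoundary_iff (hD : ∀ z, Γ.level z ≤ D) {e : Edg.{v} E r} (he : Γ.IsEdg D e)
    {x y : Vtx.{u} V E r} (h : Γ.rotEnds e = s(x, y)) {X : Set (Vtx.{u} V E r)} :
    e ∈ (Γ.rotGraph D hD r).edgeBoundary X ↔ (x ∈ X ∧ y ∉ X) ∨ (y ∈ X ∧ x ∉ X) :=
  IsLink.mem_edgeBoundary_iff (G := Γ.rotGraph D hD r) ⟨he, h⟩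

/-- The boundary of a set of vertices described by a predicate. -/
lemma mem_edgeBoundary_setOf (hD : ∀ z, Γ.level z ≤ D) {e : Edg.{v} E r} (he : Γ.IsEdg D e)
    {x y : Vtx.{u} V E r} (h : Γ.rotEnds e = s(x, y)) {P : Vtx.{u} V E r → Prop} :
    e ∈ (Γ.rotGraph D hD r).edgeBoundary {x | Γ.IsVtx D x ∧ P x} ↔
      (P x ∧ ¬ P y) ∨ (P y ∧ ¬ P x) := by
  have hx : Γ.IsVtx D x := isVtx_of_mem_rotEnds hD he (by rw [h]; simp)
  have hy : Γ.IsVtx D y := isVtx_of_mem_rotEnds hD he (by rw [h]; simp)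
  rw [mem_edgeBoundary_iff hD he h]
  simp [hx, hy]

lemma edgeBoundary_copySet (hD : ∀ z, Γ.level z ≤ D) (j : ZMod r) (k : Fin (r / 2)) :
    (Γ.rotGraph.{u, v} D hD r).edgeBoundary (Γ.copySet D j k) = {.left j k, .right j k} := by
  ext e
  by_cases he : Γ.IsEdg D e
  swap
  · refine iff_of_false (fun h ↦ he (edgeBoundary_subset h)) ?_
    rintro (rfl | rfl) <;> exact he trivial
  unfold copySet
  cases e with
  | stem j' k' f b w =>
    rw [mem_edgeBoundary_setOf hD he rfl]
    cases w <;> simp [InCopy, blobParent]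
  | clique j' k' f t p =>
    induction p using Sym2.ind with
    | _ a c =>
      rw [mem_edgeBoundary_setOf hD he (Sym2.map_mk ..)]
      have : ∀ a, InCopy j k (cliqueVtx.{u} (V := V) j' k' f t a) ↔ j' = j ∧ k' = k := by
        intro a; unfold cliqueVtx; split_ifs <;> rfl
      simp [this]
  | _ =>
    rw [mem_edgeBoundary_setOf hD he rfl]
    simp [InCopy]

lemma edgeBoundary_blobSet (hD : ∀ z, Γ.level z ≤ D) (j : ZMod r) (k : Fin (r / 2)) {f : E}
    (hf : Γ.IsFree f) :
    (Γ.rotGraph.{u, v} D hD r).edgeBoundary (Γ.blobSet D j k f) =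
      {.stem j k f false [], .stem j k f true []} := by
  ext e
  by_cases he : Γ.IsEdg D e
  swap
  · refine iff_of_false (fun h ↦ he (edgeBoundary_subset h)) ?_
    rintro (rfl | rfl) <;> exact he ⟨hf, by simp, by simp⟩
  unfold blobSet
  cases e with
  | stem j' k' f' b w =>
    rw [mem_edgeBoundary_setOf hD he rfl]
    cases w <;> cases b <;> simp [InBlob, blobParent]
  | clique j' k' f' t p =>
    induction p using Sym2.ind with
    | _ a c =>
      rw [mem_edgeBoundary_setOf hD he (Sym2.map_mk ..)]
      have : ∀ a, InBlob j k f (cliqueVtx.{u} (V := V) j' k' f' t a) ↔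
          j' = j ∧ k' = k ∧ f' = f := by
        intro a; unfold cliqueVtx; split_ifs <;> rfl
      simp [this]
  | _ =>
    rw [mem_edgeBoundary_setOf hD he rfl]
    simp [InBlob]

lemma isTwoCut_blobSet (hD : ∀ z, Γ.level z ≤ D) (j : ZMod r) (k : Fin (r / 2)) {f : E}
    (hf : Γ.IsFree f) :
    (Γ.rotGraph.{u, v} D hD r).IsTwoCut (Γ.blobSet D j k f) (.stem j k f false [])
      (.stem j k f true []) (.orig j k (Γ.ends f false)) (.orig j k (Γ.ends f true)) where
  subset := fun x hx ↦ hx.1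
  link_left := ⟨.blob j k f false [], ⟨⟨hf, by simp, by simp⟩, rfl, rfl, rfl⟩,
    ⟨hf, by simp, by simp⟩, Sym2.eq_swap⟩
  link_right := ⟨.blob j k f true [], ⟨⟨hf, by simp, by simp⟩, rfl, rfl, rfl⟩,
    ⟨hf, by simp, by simp⟩, Sym2.eq_swap⟩
  left_notMem := fun h ↦ h.2
  right_notMem := fun h ↦ h.2
  ne := by simpa using Γ.ends_ne f
  edgeBoundary_eq := edgeBoundary_blobSet hD j k hf

/-- The edge of the layered graph from which an edge of a copy stems. -/
def proj (Γ : Layered V E) : Edg.{v} E r → E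
  | .tree _ _ f => f
  | .stem _ _ f _ _ => f
  | _ => Γ.base

/-- A set that meets neither the rim nor crosses an attached tree pair has at least
the boundary of its trace on the layered graph. -/
lemma edgeBoundary_subset_image_proj (hD : ∀ z, Γ.level z ≤ D) {j : ZMod r} {k : Fin (r / 2)}
    {X : Set (Vtx.{u} V E r)} (hrim : ∀ i, .rim i ∉ X)
    (hX : ∀ f, Γ.IsFree f → (.blob j k f false [] ∈ X ↔ .blob j k f true [] ∈ X)) :
    Γ.graph.edgeBoundary {z | .orig j k z ∈ X} ⊆
      Γ.proj '' (Γ.rotGraph.{u, v} D hD r).edgeBoundary X := by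
  intro f hf
  rw [(Γ.isLink_ends f).mem_edgeBoundary_iff] at hf
  simp only [Set.mem_ofPred_eq] at hf
  -- The rim lies outside `X`, so the end of the base edge in `X` contributes the edge to its rim
  -- vertex.
  by_cases hb : f = Γ.base
  · subst hb
    obtain hf | hf := hf
    · exact ⟨.left j k, (mem_edgeBoundary_iff hD (e := .left j k) trivial rfl).2
        (.inl ⟨hf.1, hrim _⟩), rfl⟩
    · exact ⟨.right j k, (mem_edgeBoundary_iff hD (e := .right j k) trivial rfl).2
        (.inl ⟨hf.1, hrim _⟩), rfl⟩
  by_cases hu : Γ.IsUp f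
  · exact ⟨.tree j k f, (mem_edgeBoundary_iff hD (e := .tree j k f) hu rfl).2 hf.symm, rfl⟩
  have hfree : Γ.IsFree f := ⟨hb, hu⟩
  have hX := hX f hfree
  have hv : ∀ b, Γ.IsEdg.{v} D (.stem j k f b []) := fun b ↦ ⟨hfree, by simp, by simp⟩
  -- The roots of the two trees lie on the same side and the ends of `f` on different sides, so one
  -- of the two stems crosses.
  by_cases h : (.blob j k f false [] : Vtx.{u} V E r) ∈ X ↔ .orig j k (Γ.ends f false) ∈ X
  · refine ⟨.stem j k f true [], (mem_edgeBoundary_iff hD (hv true) rfl).2 ?_, rfl⟩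
    simp only [blobParent]
    tauto
  · refine ⟨.stem j k f false [], (mem_edgeBoundary_iff hD (hv false) rfl).2 ?_, rfl⟩
    simp only [blobParent]
    tauto

lemma eq_of_mem_edgeBoundary_orig (hD : ∀ z, Γ.level z ≤ D) {j : ZMod r} {k : Fin (r / 2)} {z : V}
    {e : Edg.{v} E r} (he : e ∈ (Γ.rotGraph.{u, v} D hD r).edgeBoundary {.orig j k z}) :
    (e = .left j k ∧ z = Γ.ends Γ.base false) ∨ (e = .right j k ∧ z = Γ.ends Γ.base true) ∨
      (∃ f, Γ.IsUp f ∧ e = .tree j k f ∧ (z = Γ.ends f true ∨ z = Γ.ends f false)) ∨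
      ∃ f b, Γ.IsFree f ∧ e = .stem j k f b [] ∧ z = Γ.ends f b := by
  rw [mem_edgeBoundary_singleton] at he
  obtain ⟨h1, h2⟩ := he
  cases e with
  | spoke => simp [rotEnds] at h2
  | left j' k' => simp [rotEnds] at h2; simp [h2]
  | right j' k' => simp [rotEnds] at h2; simp [h2]
  | tree j' k' f =>
    simp only [rotEnds, Sym2.mem_iff, Vtx.orig.injEq] at h2
    refine .inr (.inr (.inl ⟨f, h1, ?_⟩))
    grind
  | stem j' k' f b w =>
    cases w with
    | nil =>
      simp only [rotEnds, blobParent, Sym2.mem_iff, Vtx.orig.injEq, reduceCtorEq, false_or] at h2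
      obtain ⟨rfl, rfl, rfl⟩ := h2
      exact .inr (.inr (.inr ⟨f, b, h1.1, rfl, rfl⟩))
    | cons => simp [rotEnds, blobParent] at h2
  | cross => simp [rotEnds] at h2
  | clique j' k' f t p =>
    simp only [rotEnds, Sym2.mem_map, cliqueVtx] at h2
    grind

/-- `proj` is a bijection from the edges at a copy of `z` to the edges at `z`; surjectivity is the
trace lemma for the set consisting of this copy alone. -/
lemma ncard_edgeBoundary_orig (hD : ∀ z, Γ.level z ≤ D) (hΓ : Γ.graph.IsRGraph r)
    (j : ZMod r) (k : Fin (r / 2)) (z : V) :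
    ((Γ.rotGraph.{u, v} D hD r).edgeBoundary {.orig j k z}).ncard = r := by
  refine Eq.trans ?_ (hΓ.ncard_edgeBoundary_singleton (Set.mem_univ z))
  have hbase : ¬ Γ.IsUp Γ.base := fun h ↦ h.1 (Γ.level_base true)
  refine Set.ncard_congr (fun e _ ↦ Γ.proj e) ?_ ?_ ?_
  · intro e he
    have key : ∀ f, z = Γ.ends f false ∨ z = Γ.ends f true → f ∈ Γ.graph.edgeBoundary {z} := by
      intro f hf
      rw [(Γ.isLink_ends f).mem_edgeBoundary_iff]
      have := Γ.ends_ne f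
      simp only [Set.mem_singleton_iff]
      grind
    obtain ⟨rfl, h⟩ | ⟨rfl, h⟩ | ⟨f, -, rfl, h⟩ | ⟨f, b, -, rfl, h⟩ :=
      eq_of_mem_edgeBoundary_orig hD he
    · exact key _ (.inl h)
    · exact key _ (.inr h)
    · exact key _ h.symm
    · cases b
      · exact key _ (.inl h)
      · exact key _ (.inr h)
  · intro e e' he he' hee
    have hne := Γ.ends_ne
    obtain ⟨rfl, h⟩ | ⟨rfl, h⟩ | ⟨f, hf, rfl, h⟩ | ⟨f, b, hf, rfl, h⟩ :=
      eq_of_mem_edgeBoundary_orig hD he <;>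
    obtain ⟨rfl, h'⟩ | ⟨rfl, h'⟩ | ⟨f', hf', rfl, h'⟩ | ⟨f', b', hf', rfl, h'⟩ :=
      eq_of_mem_edgeBoundary_orig hD he' <;> simp only [proj] at hee
    · rfl
    · exact absurd (h.symm.trans h') (hne _)
    · exact absurd (hee ▸ hf') hbase
    · exact absurd hee.symm hf'.1
    · exact absurd (h'.symm.trans h) (hne _)
    · rfl
    · exact absurd (hee ▸ hf') hbase
    · exact absurd hee.symm hf'.1
    · exact absurd (hee ▸ hf) hbase
    · exact absurd (hee ▸ hf) hbase
    · rw [hee]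
    · exact absurd (hee ▸ hf) hf'.2
    · exact absurd hee hf.1
    · exact absurd hee hf.1
    · exact absurd (hee ▸ hf') hf.2
    · subst hee
      have := hne f
      cases b <;> cases b' <;> first | rfl | exact absurd (h.symm.trans h') (by grind)
  · intro f hf
    obtain ⟨e, he, rfl⟩ := edgeBoundary_subset_image_proj.{u, v} hD
      (X := {.orig j k z}) (j := j) (k := k) (by simp) (by simp) (by simpa using hf)
    exact ⟨e, he, rfl⟩

/-- For odd `r`, `1 + r / 2 + r / 2 = r`. This counts the edges at a rim vertex (one spoke and two
bundles) and the smallest odd cuts of the wheel. -/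
lemma card_option_sum_fin (hr : Odd r) : Nat.card (Option (Fin (r / 2) ⊕ Fin (r / 2))) = r := by
  obtain ⟨n, rfl⟩ := hr
  simp
  omega

lemma ncard_edgeBoundary_rim (hD : ∀ z, Γ.level z ≤ D) (hr : Odd r) (j : ZMod r) :
    ((Γ.rotGraph.{u, v} D hD r).edgeBoundary {.rim j}).ncard = r := by
  let g : Option (Fin (r / 2) ⊕ Fin (r / 2)) → Edg.{v} E r
    | none => .spoke j
    | some (.inl k) => .left j k
    | some (.inr k) => .right (j - 1) k
  have hg : Function.Injective g := by
    rintro (_ | _ | _) (_ | _ | _) h <;> simp_all [g]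
  refine Eq.trans ?_ ((ncard_range_of_injective hg).trans (card_option_sum_fin hr))
  congr 1
  ext e
  rw [mem_edgeBoundary_singleton]
  constructor
  · rintro ⟨h1, h2⟩
    cases e with
    | spoke j' => simp [rotEnds] at h2; exact ⟨none, by simp [g, h2]⟩
    | left j' k => simp [rotEnds] at h2; exact ⟨some (.inl k), by simp [g, h2]⟩
    | right j' k => simp [rotEnds] at h2; exact ⟨some (.inr k), by simp [g, h2]⟩
    | tree => simp [rotEnds] at h2
    | stem j' k' f b w => cases w <;> simp [rotEnds, blobParent] at h2
    | cross => simp [rotEnds] at h2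
    | clique j' k' f t p =>
      simp only [rotEnds, Sym2.mem_map, cliqueVtx] at h2
      grind
  · rintro ⟨_ | _ | _, rfl⟩ <;> exact ⟨trivial, by simp [g, rotEnds]⟩

lemma ncard_edgeBoundary_root (hD : ∀ z, Γ.level z ≤ D) :
    ((Γ.rotGraph.{u, v} D hD r).edgeBoundary {.root}).ncard = r := by
  have hg : Function.Injective (Edg.spoke.{v} (E := E) (r := r)) := fun _ _ h ↦ by simpa using h
  refine Eq.trans ?_ ((ncard_range_of_injective hg).trans (Nat.card_zmod r))
  congr 1
  ext e
  rw [mem_edgeBoundary_singleton]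
  constructor
  · rintro ⟨h1, h2⟩
    cases e with
    | spoke j' => exact ⟨j', rfl⟩
    | left => simp [rotEnds] at h2
    | right => simp [rotEnds] at h2
    | tree => simp [rotEnds] at h2
    | stem j' k' f b w => cases w <;> simp [rotEnds, blobParent] at h2
    | cross => simp [rotEnds] at h2
    | clique j' k' f t p =>
      simp only [rotEnds, Sym2.mem_map, cliqueVtx] at h2
      grind
  · rintro ⟨j, rfl⟩
    exact ⟨trivial, by simp [rotEnds]⟩

lemma ncard_edgeBoundary_rotGraph (hD : ∀ z, Γ.level z ≤ D) (hr : Odd r) (hΓ : Γ.graph.IsRGraph r)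
    {x : Vtx.{u} V E r} (hx : x ∈ V(Γ.rotGraph.{u, v} D hD r)) :
    ((Γ.rotGraph.{u, v} D hD r).edgeBoundary {x}).ncard = r := by
  cases x with
  | root => exact ncard_edgeBoundary_root hD
  | rim j => exact ncard_edgeBoundary_rim hD hr j
  | orig j k z => exact ncard_edgeBoundary_orig hD hΓ j k z
  | blob j k f b w => exact ncard_edgeBoundary_blob hr hD hx

lemma finite_vertexSet_rotGraph [Finite V] [Finite E] (hD : ∀ z, Γ.level z ≤ D) (hr : Odd r) :
    V(Γ.rotGraph.{u, v} D hD r).Finite := by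
  have : NeZero r := ⟨by rintro rfl; simp at hr⟩
  have hw : {w : List (ZMod r) | w.length ≤ D + 1}.Finite := List.finite_length_le _ _
  refine (((Set.finite_singleton Vtx.root).union (Set.finite_range Vtx.rim)).union
    (Set.finite_range fun p : ZMod r × Fin (r / 2) × V ↦ Vtx.orig p.1 p.2.1 p.2.2)).union
    (((Set.finite_univ (α := ZMod r × Fin (r / 2) × E × Bool)).prod hw).image
      fun p ↦ Vtx.blob p.1.1 p.1.2.1 p.1.2.2.1 p.1.2.2.2 p.2) |>.subset fun x hx ↦ ?_
  cases x with
  | root => exact .inl (.inl (.inl rfl))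
  | rim j => exact .inl (.inl (.inr ⟨j, rfl⟩))
  | orig j k z => exact .inl (.inr ⟨(j, k, z), rfl⟩)
  | blob j k f b w =>
    refine .inr ⟨((j, k, f, b), w), ⟨Set.mem_univ _, ?_⟩, rfl⟩
    have := hx.2.2
    unfold height at this
    change w.length ≤ D + 1
    omega

/-- Each edge lies in the boundary of some vertex, and these boundaries are finite because their
`ncard` is `r ≠ 0`. -/
lemma finite_edgeSet_rotGraph [Finite V] [Finite E]
    (hD : ∀ z, Γ.level z ≤ D) (hr : Odd r) (hΓ : Γ.graph.IsRGraph r) : E(Γ.rotGraph.{u, v} D hD r).Finite := by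
  refine ((finite_vertexSet_rotGraph.{u, v} hD hr).biUnion fun x hx ↦
    Set.finite_of_ncard_ne_zero (s := (Γ.rotGraph.{u, v} D hD r).edgeBoundary {x}) ?_).subset ?_
  · rw [ncard_edgeBoundary_rotGraph hD hr hΓ hx]
    rintro rfl
    simp at hr
  · intro e he
    obtain ⟨x, y, hl⟩ := exists_isLink_of_mem_edgeSet he
    exact Set.mem_biUnion hl.left_mem
      ((mem_edgeBoundary_singleton hD).2 ⟨hl.1, by rw [hl.2]; simp⟩)

end Layered

end Graph

/-! ### The odd-cut condition for the rotation graph. -/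

namespace Graph

/-- Removing disjoint subsets of even size does not change the parity of the size. -/
lemma odd_ncard_sdiff_biUnion {α ι : Type*} (F : Finset ι) (S : ι → Set α)
    (heven : ∀ i ∈ F, Even (S i).ncard)
    (hdisj : ∀ i ∈ F, ∀ j ∈ F, i ≠ j → Disjoint (S i) (S j)) {X : Set α} (hX : X.Finite)
    (hsat : ∀ i ∈ F, Disjoint X (S i) ∨ S i ⊆ X) :
    Odd (X \ ⋃ i ∈ F, S i).ncard ↔ Odd X.ncard := by
  classical
  induction F using Finset.induction_on generalizing X with
  | empty => simp
  | @insert i F hi ih =>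
    have hF : ∀ {j}, j ∈ F → j ∈ insert i F := Finset.mem_insert_of_mem
    have him := Finset.mem_insert_self i F
    rw [Finset.set_biUnion_insert, ← Set.sdiff_sdiff,
      ih (fun j hj ↦ heven j (hF hj)) (fun j hj k hk ↦ hdisj j (hF hj) k (hF hk)) hX.sdiff]
    · obtain h | h := hsat i him
      · rw [h.sdiff_eq_left]
      · have h1 := Set.ncard_sdiff_add_ncard_of_subset h hX
        have h2 := heven i him
        grind
    · intro j hj
      obtain h | h := hsat j (hF hj)
      · exact .inl (h.mono_left Set.sdiff_subset)
      · exact .inr (Set.subset_sdiff.2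
          ⟨h, hdisj j (hF hj) i him (by rintro rfl; exact hi hj)⟩)

/-- A nonempty set of residues closed under adding one contains all residues. -/
lemma eq_univ_of_add_one_mem {r : ℕ} [NeZero r] {K : Set (ZMod r)} (hK : K.Nonempty)
    (h : ∀ j ∈ K, j + 1 ∈ K) : K = Set.univ := by
  obtain ⟨i, hi⟩ := hK
  have key : ∀ n : ℕ, i + n ∈ K := by
    intro n
    induction n with
    | zero => simpa using hi
    | succ n ih => rw [Nat.cast_succ, ← add_assoc]; exact h _ ih
  refine Set.eq_univ_of_forall fun x ↦ ?_
  have := key (x - i).val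
  rwa [ZMod.natCast_zmod_val, add_sub_cancel] at this

namespace Layered

variable {V E : Type} {r : ℕ} {Γ : Layered V E} {D : ℕ}

lemma even_ncard_of_edgeBoundary_eq_two [Finite V] [Finite E]
    (hD : ∀ z, Γ.level z ≤ D) (hr : Odd r) (hΓ : Γ.graph.IsRGraph r) {S : Set (Vtx.{u} V E r)}
    (hS : S ⊆ V(Γ.rotGraph.{u, v} D hD r))
    (h : ((Γ.rotGraph.{u, v} D hD r).edgeBoundary S).ncard = 2) : Even S.ncard := by
  have h1 := odd_ncard_edgeBoundary (finite_edgeSet_rotGraph.{u, v} hD hr hΓ)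
    ((finite_vertexSet_rotGraph.{u, v} hD hr).subset hS)
    fun x hx ↦ by rwa [ncard_edgeBoundary_rotGraph hD hr hΓ (hS hx)]
  rw [h] at h1
  rw [← Nat.not_odd_iff_even, ← h1]
  decide

/-- Each colour occurs exactly once at every vertex of `Y`, so by parity it occurs in the boundary
of the odd set `Y`; there are `r` colours. -/
lemma le_ncard_edgeBoundary_of_subset_blobSet [Finite V] [Finite E]
    (hD : ∀ z, Γ.level z ≤ D) (hr : Odd r) (hΓ : Γ.graph.IsRGraph r) {j : ZMod r} {k : Fin (r / 2)} {f : E}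
    {Y : Set (Vtx.{u} V E r)} (hY : Y ⊆ Γ.blobSet D j k f) (ho : Odd Y.ncard) :
    r ≤ ((Γ.rotGraph.{u, v} D hD r).edgeBoundary Y).ncard := by
  have hE := finite_edgeSet_rotGraph.{u, v} hD hr hΓ
  have hYf : Y.Finite := (finite_vertexSet_rotGraph.{u, v} hD hr).subset fun x hx ↦ (hY hx).1
  have hsurj : colour '' ((Γ.rotGraph.{u, v} D hD r).edgeBoundary Y) = Set.univ := by
    refine Set.eq_univ_of_forall fun c ↦ ?_
    have h1 := (odd_ncard_edgeBoundary_inter hE {e | colour e = c} hYf ?_).2 ho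
    · obtain ⟨e, he, hc⟩ := Set.nonempty_of_ncard_ne_zero h1.pos.ne'
      exact ⟨e, he, hc⟩
    · intro x hx
      obtain ⟨h1, h2⟩ := hY hx
      cases x with
      | blob j' k' f' b w =>
        have hbij := colour_edgeAt_bijective.{u, v} hr hD h1
        rw [edgeBoundary_blob hD h1]
        obtain ⟨d, hd⟩ := hbij.surjective c
        have : Set.range (Γ.edgeAt.{v} D j' k' f' b w) ∩ {e | colour e = c} =
            {Γ.edgeAt D j' k' f' b w d} := by
          refine Set.eq_singleton_iff_unique_mem.2 ⟨⟨⟨d, rfl⟩, hd⟩, ?_⟩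
          rintro _ ⟨⟨d', rfl⟩, hd'⟩
          rw [hbij.injective (hd'.trans hd.symm)]
        rw [this, Set.ncard_singleton]
        exact odd_one
      | _ => exact h2.elim
  calc r = (colour '' ((Γ.rotGraph.{u, v} D hD r).edgeBoundary Y)).ncard := by
        rw [hsurj, Set.ncard_univ, Nat.card_zmod]
    _ ≤ _ := Set.ncard_image_le (hE.subset edgeBoundary_subset)

lemma ncard_edgeBoundary_blobSet (hD : ∀ z, Γ.level z ≤ D) (j : ZMod r) (k : Fin (r / 2))
    {f : E} (hf : Γ.IsFree f) :
    ((Γ.rotGraph.{u, v} D hD r).edgeBoundary (Γ.blobSet D j k f)).ncard = 2 := by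
  rw [edgeBoundary_blobSet hD j k hf, Set.ncard_pair (by simp)]

lemma ncard_edgeBoundary_copySet (hD : ∀ z, Γ.level z ≤ D) (j : ZMod r) (k : Fin (r / 2)) :
    ((Γ.rotGraph.{u, v} D hD r).edgeBoundary (Γ.copySet D j k)).ncard = 2 := by
  rw [edgeBoundary_copySet hD j k, Set.ncard_pair (by simp)]

lemma disjoint_blobSet (j : ZMod r) (k : Fin (r / 2)) {f f' : E} (h : f ≠ f') :
    Disjoint (Γ.blobSet.{u} D j k f) (Γ.blobSet D j k f') := by
  rw [Set.disjoint_left]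
  rintro x ⟨-, h1⟩ ⟨-, h2⟩
  cases x with
  | blob => exact h (h1.2.2.symm.trans h2.2.2)
  | _ => exact h1

/-- After uncrossing with the tree pairs, which are even, a saturated odd set has an odd trace on
`G`. The boundary of the trace lies in the image under `proj` of the boundary of the set. -/
lemma le_ncard_edgeBoundary_of_subset_copySet [Finite V] [Finite E]
    (hD : ∀ z, Γ.level z ≤ D) (hr : Odd r) (hΓ : Γ.graph.IsRGraph r) {j : ZMod r} {k : Fin (r / 2)}
    {X : Set (Vtx.{u} V E r)} (hX : X ⊆ Γ.copySet D j k) (ho : Odd X.ncard) :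
    r ≤ ((Γ.rotGraph.{u, v} D hD r).edgeBoundary X).ncard := by
  classical
  have := Fintype.ofFinite E
  have hE := finite_edgeSet_rotGraph.{u, v} hD hr hΓ
  have hV := finite_vertexSet_rotGraph.{u, v} hD hr
  have hfree : ∀ f ∈ (Finset.univ.filter fun f ↦ Γ.IsFree f), Γ.IsFree f := fun f hf ↦
    (Finset.mem_filter.1 hf).2
  refine le_ncard_edgeBoundary_of_saturated hV hE
    (fun x hx ↦ by rwa [ncard_edgeBoundary_rotGraph hD hr hΓ hx]) (W := Γ.copySet D j k)
    (fun x hx ↦ hx.1) (Finset.univ.filter fun f ↦ Γ.IsFree f) (Γ.blobSet D j k) ?_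
    (fun f hf ↦ ncard_edgeBoundary_blobSet hD j k (hfree f hf))
    (fun f _ Y hY hYo ↦ le_ncard_edgeBoundary_of_subset_blobSet hD hr hΓ hY hYo)
    (fun f _ f' _ hff ↦ disjoint_blobSet j k hff) ?_ X hX ho
  · rintro f hf x ⟨h1, h2⟩
    cases x with
    | blob => exact ⟨h1, h2.1, h2.2.1⟩
    | _ => exact h2.elim
  · intro X hX ho hsat
    have ho' := (odd_ncard_sdiff_biUnion (Finset.univ.filter fun f ↦ Γ.IsFree f)
      (Γ.blobSet.{u} D j k) (fun f hf ↦ even_ncard_of_edgeBoundary_eq_two.{u, v} hD hr hΓ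
        (fun x hx ↦ hx.1) (ncard_edgeBoundary_blobSet hD j k (hfree f hf)))
      (fun f _ f' _ hff ↦ disjoint_blobSet j k hff) (hV.subset fun x hx ↦ (hX hx).1) hsat).2 ho
    have heq : X \ ⋃ f ∈ (Finset.univ.filter fun f ↦ Γ.IsFree f), Γ.blobSet.{u} D j k f =
        Vtx.orig j k '' {z | .orig j k z ∈ X} := by
      ext x
      simp only [Set.mem_sdiff, Set.mem_iUnion, Finset.mem_filter, Finset.mem_univ, true_and,
        exists_prop, not_exists, not_and, Set.mem_image, Set.mem_ofPred_eq]
      constructor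
      · rintro ⟨h1, h2⟩
        obtain ⟨h3, h4⟩ := hX h1
        cases x with
        | root => exact h4.elim
        | rim => exact h4.elim
        | orig j' k' z =>
          obtain ⟨rfl, rfl⟩ := h4
          exact ⟨z, h1, rfl⟩
        | blob j' k' f b w => exact absurd ⟨h3, h4.1, h4.2, rfl⟩ (h2 f h3.1)
      · rintro ⟨z, hz, rfl⟩
        exact ⟨hz, fun f _ h ↦ h.2⟩
    have hinj : Function.Injective (Vtx.orig.{u} (V := V) (E := E) j k) := fun _ _ h ↦ by
      simpa using h
    rw [heq, Set.ncard_image_of_injective _ hinj] at ho'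
    have hsub := edgeBoundary_subset_image_proj.{u, v} hD (j := j) (k := k) (X := X)
      (fun i hi ↦ (hX hi).2) (fun f hf ↦ by
        have hm : ∀ b, (.blob j k f b [] : Vtx.{u} V E r) ∈ Γ.blobSet D j k f := fun b ↦
          ⟨⟨hf, by simp, by simp⟩, rfl, rfl, rfl⟩
        obtain h | h := hsat f (by simpa using hf)
        · exact iff_of_false (fun h' ↦ Set.disjoint_left.1 h h' (hm false))
            (fun h' ↦ Set.disjoint_left.1 h h' (hm true))
        · exact iff_of_true (h (hm false)) (h (hm true)))
    have hfin := hE.subset (edgeBoundary_subset (X := X))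
    calc r ≤ (Γ.graph.edgeBoundary {z | .orig j k z ∈ X}).ncard :=
          hΓ.le_boundary _ (Set.subset_univ _) ho'
      _ ≤ _ := Set.ncard_le_ncard hsub (hfin.image _)
      _ ≤ _ := Set.ncard_image_le hfin

/-- The wheel that remains after contracting the copies satisfies the odd-cut condition. -/
lemma le_ncard_edgeBoundary_of_saturated_copySet [Finite V] [Finite E]
    (hD : ∀ z, Γ.level z ≤ D) (hr : Odd r) (hΓ : Γ.graph.IsRGraph r) {X : Set (Vtx.{u} V E r)}
    (ho : Odd (X ∩ insert .root (Set.range .rim)).ncard)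
    (hsat : ∀ j k, ((.orig j k (Γ.ends Γ.base false) : Vtx.{u} V E r) ∈ X ↔
      .orig j k (Γ.ends Γ.base true) ∈ X)) :
    r ≤ ((Γ.rotGraph.{u, v} D hD r).edgeBoundary X).ncard := by
  have : NeZero r := ⟨by rintro rfl; simp at hr⟩
  have hE := finite_edgeSet_rotGraph.{u, v} hD hr hΓ
  -- `K` collects the rim vertices separated from the root. It is odd in both cases: if the root
  -- lies in `X`, the complement of `K` is even and `r` is odd.
  let K : Set (ZMod r) := {j | ¬ ((.rim j : Vtx.{u} V E r) ∈ X ↔ .root ∈ X)}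
  have hinj : Function.Injective (Vtx.rim.{u} (V := V) (E := E) (r := r)) := fun _ _ h ↦ by
    simpa using h
  have hKo : Odd K.ncard := by
    by_cases hroot : (.root : Vtx.{u} V E r) ∈ X
    · have h1 : X ∩ insert .root (Set.range .rim) = insert .root (.rim '' Kᶜ) := by
        ext x
        cases x <;> simp [K, hroot]
      rw [h1, Set.ncard_insert_of_notMem (by simp) (Set.toFinite _),
        Set.ncard_image_of_injective _ hinj] at ho
      have h2 := Set.ncard_add_ncard_compl K
      rw [Nat.card_zmod] at h2
      grind
    · have h1 : X ∩ insert .root (Set.range .rim) = .rim '' K := by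
        ext x
        cases x <;> simp [K, hroot]
      rwa [h1, Set.ncard_image_of_injective _ hinj] at ho
  -- The label identifies the two edges attaching a copy, so each copy separating its two rim
  -- vertices contributes one label.
  let lab : Edg.{v} E r → ZMod r × Option (Fin (r / 2))
    | .spoke j => (j, none)
    | .left j k => (j, some k)
    | .right j k => (j, some k)
    | _ => (0, none)
  have hspoke : ∀ j ∈ K, (j, none) ∈ lab '' (Γ.rotGraph.{u, v} D hD r).edgeBoundary X := by
    intro j hj
    refine ⟨.spoke j, (mem_edgeBoundary_iff hD (e := .spoke j) trivial rfl).2 ?_, rfl⟩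
    simp only [K, Set.mem_ofPred_eq] at hj
    tauto
  have hrim : ∀ j, ¬ (j ∈ K ↔ j + 1 ∈ K) → ∀ k,
      (j, some k) ∈ lab '' (Γ.rotGraph.{u, v} D hD r).edgeBoundary X := by
    intro j hj k
    have h1 := hsat j k
    by_cases h2 : (.orig j k (Γ.ends Γ.base false) : Vtx.{u} V E r) ∈ X ↔ .rim j ∈ X
    · refine ⟨.right j k, (mem_edgeBoundary_iff hD (e := .right j k) trivial rfl).2 ?_, rfl⟩
      simp only [K, Set.mem_ofPred_eq] at hj
      tauto
    · refine ⟨.left j k, (mem_edgeBoundary_iff hD (e := .left j k) trivial rfl).2 ?_, rfl⟩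
      tauto
  have hfin := hE.subset (edgeBoundary_subset (X := X))
  refine le_trans ?_ (Set.ncard_image_le (f := lab) hfin)
  by_cases hKu : K = Set.univ
  · have hg : Function.Injective fun j : ZMod r ↦ (j, (none : Option (Fin (r / 2)))) :=
      fun _ _ h ↦ by simpa using h
    refine (Nat.card_zmod r ▸ ncard_range_of_injective hg).symm.le.trans
      (Set.ncard_le_ncard ?_ (hfin.image _))
    rintro _ ⟨j, rfl⟩
    exact hspoke j (hKu ▸ Set.mem_univ j)
  have hKne : K.Nonempty := Set.nonempty_of_ncard_ne_zero hKo.pos.ne'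
  obtain ⟨j₁, h₁, h₁'⟩ : ∃ j ∈ K, j + 1 ∉ K := by
    by_contra! h
    exact hKu (eq_univ_of_add_one_mem hKne h)
  obtain ⟨j₂, h₂, h₂'⟩ : ∃ j ∉ K, j + 1 ∈ K := by
    by_contra! h
    have := eq_univ_of_add_one_mem (K := Kᶜ) (Set.nonempty_compl.2 hKu) h
    exact hKne.ne_empty (Set.compl_univ_iff.1 this)
  -- Going around the rim, `K` is left at `j₁` and entered at `j₂`. Each change costs `r / 2`
  -- labels, and the spoke at `j₁` is one more.
  let g : Option (Fin (r / 2) ⊕ Fin (r / 2)) → ZMod r × Option (Fin (r / 2))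
    | none => (j₁, none)
    | some (.inl k) => (j₁, some k)
    | some (.inr k) => (j₂, some k)
  have hj : j₁ ≠ j₂ := by rintro rfl; exact h₂ h₁
  have hg : Function.Injective g := by
    rintro (_ | _ | _) (_ | _ | _) h <;> simp_all [g]
  refine ((ncard_range_of_injective hg).trans (card_option_sum_fin hr)).symm.le.trans
    (Set.ncard_le_ncard ?_ (hfin.image _))
  rintro _ ⟨_ | k | k, rfl⟩
  · exact hspoke j₁ h₁
  · exact hrim j₁ (by tauto) k
  · exact hrim j₂ (by tauto) k

/-- Uncrossing once more, now with the copies. These are even, so a saturated odd set meets root and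
rim in an odd number of vertices and the wheel bound applies. -/
lemma rotGraph_isRGraph [Finite V] [Finite E]
    (hD : ∀ z, Γ.level z ≤ D) (hr : Odd r) (hΓ : Γ.graph.IsRGraph r) : (Γ.rotGraph.{u, v} D hD r).IsRGraph r := by
  classical
  have : NeZero r := ⟨by rintro rfl; simp at hr⟩
  have hE := finite_edgeSet_rotGraph.{u, v} hD hr hΓ
  have hV := finite_vertexSet_rotGraph.{u, v} hD hr
  have := rotGraph_simple.{u, v} (r := r) hD
  have hdeg : ∀ x ∈ V(Γ.rotGraph.{u, v} D hD r), _ := fun x hx ↦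
    ncard_edgeBoundary_rotGraph.{u, v} hD hr hΓ hx
  have hdisj : ∀ i ∈ (Finset.univ : Finset (ZMod r × Fin (r / 2))), ∀ j ∈ Finset.univ, i ≠ j →
      Disjoint (Γ.copySet.{u} D i.1 i.2) (Γ.copySet D j.1 j.2) := by
    intro i _ j _ hij
    rw [Set.disjoint_left]
    rintro x ⟨-, h1⟩ ⟨-, h2⟩
    refine hij ?_
    cases x with
    | orig => exact Prod.ext (h1.1.symm.trans h2.1) (h1.2.symm.trans h2.2)
    | blob => exact Prod.ext (h1.1.symm.trans h2.1) (h1.2.symm.trans h2.2)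
    | _ => exact h1.elim
  refine isRGraph_of_edgeBoundary hV hE hdeg ?_
  refine le_ncard_edgeBoundary_of_saturated hV hE (fun x hx ↦ by rwa [hdeg x hx]) subset_rfl
    Finset.univ (fun i : ZMod r × Fin (r / 2) ↦ Γ.copySet D i.1 i.2) (fun i _ x hx ↦ hx.1)
    (fun i _ ↦ ncard_edgeBoundary_copySet hD i.1 i.2)
    (fun i _ Y hY hYo ↦ le_ncard_edgeBoundary_of_subset_copySet hD hr hΓ hY hYo) hdisj ?_
  intro X hX ho hsat
  have ho' := (odd_ncard_sdiff_biUnion Finset.univ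
    (fun i : ZMod r × Fin (r / 2) ↦ Γ.copySet.{u} D i.1 i.2)
    (fun i _ ↦ even_ncard_of_edgeBoundary_eq_two.{u, v} hD hr hΓ
      (fun x hx ↦ hx.1) (ncard_edgeBoundary_copySet hD i.1 i.2)) hdisj (hV.subset hX) hsat).2 ho
  refine le_ncard_edgeBoundary_of_saturated_copySet hD hr hΓ ?_ ?_
  · convert ho' using 2
    ext x
    simp only [Set.mem_inter_iff, Set.mem_sdiff, Set.mem_iUnion, Finset.mem_univ, exists_prop,
      true_and, Prod.exists, not_exists]
    refine and_congr_right fun hx ↦ ?_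
    have hxv : Γ.IsVtx D x := hX hx
    cases x with
    | root => exact iff_of_true (by simp) (fun j k h ↦ h.2)
    | rim i => exact iff_of_true (by simp) (fun j k h ↦ h.2)
    | orig i k z => exact iff_of_false (by simp) (fun h ↦ h i k ⟨hxv, rfl, rfl⟩)
    | blob i k f b w => exact iff_of_false (by simp) (fun h ↦ h i k ⟨hxv, rfl, rfl⟩)
  · intro j k
    have hm : ∀ z, (.orig j k z : Vtx.{u} V E r) ∈ Γ.copySet D j k := fun z ↦
      ⟨trivial, rfl, rfl⟩
    obtain h | h := hsat (j, k) (Finset.mem_univ _)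
    · exact iff_of_false (fun h' ↦ Set.disjoint_left.1 h h' (hm _))
        (fun h' ↦ Set.disjoint_left.1 h h' (hm _))
    · exact iff_of_true (h (hm _)) (h (hm _))

end Layered

end Graph

/-! ### Recovering the layered graph by 2-cut reductions. -/

namespace Graph

lemma Isomorphic.symm {α α' β β' : Type*} {G : Graph α β} {H : Graph α' β'}
    (h : G.Isomorphic H) : H.Isomorphic G := by
  obtain ⟨f, g, hfg⟩ := h
  refine ⟨f.symm, g.symm, fun e x y ↦ ?_⟩
  rw [hfg]
  simp

lemma Isomorphic.trans {α α' α'' β β' β'' : Type*} {G : Graph α β} {H : Graph α' β'}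
    {K : Graph α'' β''} (h : G.Isomorphic H) (h' : H.Isomorphic K) : G.Isomorphic K := by
  obtain ⟨f, g, hfg⟩ := h
  obtain ⟨f', g', hfg'⟩ := h'
  exact ⟨f.trans f', g.trans g', fun e x y ↦ (hfg ..).trans (hfg' ..)⟩

lemma edgeBoundary_vertexSet_sdiff {α : Type u} {β : Type v} (G : Graph α β) {X : Set α} :
    G.edgeBoundary (V(G) \ X) = G.edgeBoundary X := by
  ext e
  by_cases he : e ∈ E(G)
  · obtain ⟨x, y, h⟩ := G.exists_isLink_of_mem_edgeSet he
    have hx := h.left_mem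
    have hy := h.right_mem
    rw [h.mem_edgeBoundary_iff, h.mem_edgeBoundary_iff]
    simp only [Set.mem_sdiff, hx, hy, true_and]
    tauto
  · exact iff_of_false (fun h ↦ he (edgeBoundary_subset h)) (fun h ↦ he (edgeBoundary_subset h))

namespace Layered

variable {V E : Type} {r : ℕ} {Γ : Layered V E} {D : ℕ}

/-- Everything outside one copy plays the role of the missing base edge: reducing it joins the two
base ends. -/
lemma isTwoCut_compl_copySet (hD : ∀ z, Γ.level z ≤ D) (j : ZMod r) (k : Fin (r / 2)) :
    (Γ.rotGraph.{u, v} D hD r).IsTwoCut (V(Γ.rotGraph.{u, v} D hD r) \ Γ.copySet D j k)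
      (.left j k) (.right j k) (.orig j k (Γ.ends Γ.base false))
      (.orig j k (Γ.ends Γ.base true)) where
  subset := Set.sdiff_subset
  link_left := ⟨.rim j, ⟨trivial, fun h ↦ h.2⟩, trivial, rfl⟩
  link_right := ⟨.rim (j + 1), ⟨trivial, fun h ↦ h.2⟩, trivial, rfl⟩
  left_notMem := fun h ↦ h.2 ⟨trivial, rfl, rfl⟩
  right_notMem := fun h ↦ h.2 ⟨trivial, rfl, rfl⟩
  ne := by simpa using Γ.ends_ne Γ.base
  edgeBoundary_eq := by rw [edgeBoundary_vertexSet_sdiff, edgeBoundary_copySet]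

lemma not_isUp_base : ¬ Γ.IsUp Γ.base := fun h ↦ h.1 (Γ.level_base true)

open scoped Classical in
variable (Γ D) in
/-- The set of vertices replacing the edge `f` in the copy with index `j`, `k`. -/
noncomputable def cutSet (hD : ∀ z, Γ.level z ≤ D) (j : ZMod r) (k : Fin (r / 2)) (f : E) :
    Set (Vtx.{u} V E r) :=
  -- The vertex set does not depend on the universe of the edges, so that universe is fixed as `0`.
  if f = Γ.base then V(Γ.rotGraph.{u, 0} D hD r) \ Γ.copySet D j k else Γ.blobSet D j k f

open scoped Classical in
variable (Γ) in
/-- The edge at the end `b` of `f` in the copy with index `j`, `k`, if `f` is not a tree edge. -/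
noncomputable def cutEdge (j : ZMod r) (k : Fin (r / 2)) (b : Bool) (f : E) : Edg.{v} E r :=
  if f = Γ.base then bif b then .right j k else .left j k else .stem j k f b []

lemma isTwoCut_cutSet (hD : ∀ z, Γ.level z ≤ D) (j : ZMod r) (k : Fin (r / 2)) {f : E}
    (hf : ¬ Γ.IsUp f) :
    (Γ.rotGraph.{u, v} D hD r).IsTwoCut (Γ.cutSet D hD j k f) (Γ.cutEdge j k false f)
      (Γ.cutEdge j k true f) (.orig j k (Γ.ends f false)) (.orig j k (Γ.ends f true)) := by
  unfold cutSet cutEdge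
  split_ifs with h
  · subst h
    exact isTwoCut_compl_copySet hD j k
  · exact isTwoCut_blobSet hD j k ⟨h, hf⟩

lemma orig_notMem_cutSet (hD : ∀ z, Γ.level z ≤ D) (j : ZMod r) (k : Fin (r / 2)) (f : E) (z : V) :
    (.orig j k z : Vtx.{u} V E r) ∉ Γ.cutSet D hD j k f := by
  unfold cutSet
  split_ifs with h
  · exact fun h ↦ h.2 ⟨trivial, rfl, rfl⟩
  · exact fun h ↦ h.2

lemma blobSet_subset_copySet (j : ZMod r) (k : Fin (r / 2)) (f : E) :
    Γ.blobSet.{u} D j k f ⊆ Γ.copySet D j k := by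
  rintro x ⟨h1, h2⟩
  cases x with
  | blob => exact ⟨h1, h2.1, h2.2.1⟩
  | _ => exact h2.elim

lemma disjoint_cutSet (hD : ∀ z, Γ.level z ≤ D) (j : ZMod r) (k : Fin (r / 2)) {f f' : E}
    (h : f ≠ f') : Disjoint (Γ.cutSet.{u} D hD j k f) (Γ.cutSet D hD j k f') := by
  unfold cutSet
  split_ifs with h1 h2 h2
  · exact absurd (h1.trans h2.symm) h
  · exact Set.disjoint_of_subset_right (blobSet_subset_copySet j k f') disjoint_sdiff_self_left
  · exact Set.disjoint_of_subset_left (blobSet_subset_copySet j k f) disjoint_sdiff_self_right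
  · exact disjoint_blobSet j k h

/-- The vertices outside all the sets `cutSet` are those of one copy of the layered graph. -/
lemma forall_notMem_cutSet_iff (hD : ∀ z, Γ.level z ≤ D) (j : ZMod r) (k : Fin (r / 2))
    {x : Vtx.{u} V E r} (hx : Γ.IsVtx D x) :
    (∀ f, ¬ Γ.IsUp f → x ∉ Γ.cutSet D hD j k f) ↔ ∃ z, .orig j k z = x := by
  constructor
  · intro h
    have h1 : x ∈ Γ.copySet D j k := by
      by_contra h1
      refine h _ not_isUp_base ?_
      rw [cutSet, if_pos rfl]
      exact ⟨hx, h1⟩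
    obtain ⟨-, h2⟩ := h1
    cases x with
    | orig j' k' z => obtain ⟨rfl, rfl⟩ := h2; exact ⟨z, rfl⟩
    | blob j' k' f b w =>
      refine absurd ?_ (h f hx.1.2)
      rw [cutSet, if_neg hx.1.1]
      exact ⟨hx, h2.1, h2.2, rfl⟩
    | _ => exact h2.elim
  · rintro ⟨z, rfl⟩ f -
    exact orig_notMem_cutSet hD j k f z

lemma rotGraph_isLink_orig (hD : ∀ z, Γ.level z ≤ D) (j : ZMod r) (k : Fin (r / 2))
    {e : Edg.{v} E r} {z w : V} :
    (Γ.rotGraph.{u, v} D hD r).IsLink e (.orig j k z) (.orig j k w) ↔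
      ∃ f, Γ.IsUp f ∧ e = .tree j k f ∧ s(z, w) = s(Γ.ends f false, Γ.ends f true) := by
  constructor
  · rintro ⟨h1, h2⟩
    cases e with
    | tree j' k' f =>
      simp only [rotEnds, Sym2.eq_iff, Vtx.orig.injEq] at h2
      refine ⟨f, h1, ?_⟩
      rw [Sym2.eq_iff]
      grind
    | clique j' k' f t p =>
      induction p using Sym2.ind with
      | _ a c =>
        simp only [rotEnds, Sym2.map_mk, Sym2.eq_iff, cliqueVtx] at h2
        grind
    | _ => simp [rotEnds] at h2
  · rintro ⟨f, hf, rfl, h⟩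
    refine ⟨hf, ?_⟩
    simp only [rotEnds, Sym2.eq_iff] at h ⊢
    grind

/-- A property preserved by two-cut reductions passes from the rotation graph to
the layered graph. -/
lemma of_rotGraph [Finite V] [Finite E] (hD : ∀ z, Γ.level z ≤ D) (hr : Odd r) (hr' : 1 < r)
    (hΓ : Γ.graph.IsRGraph r) {A : ∀ (α : Type u) (β : Type v), Graph α β → Prop}
    (hA : PreservedByTwoCutReduction A r) (h : A _ _ (Γ.rotGraph.{u, v} D hD r)) :
    ∃ R : Graph (Vtx.{u} V E r) (Edg.{v} E r), A _ _ R ∧ Γ.graph.Isomorphic R := by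
  classical
  have := Fintype.ofFinite E
  -- A copy exists because `1 < r`.
  let k : Fin (r / 2) := ⟨0, by omega⟩
  let F : Finset E := Finset.univ.filter fun f ↦ ¬ Γ.IsUp f
  have hF : ∀ f, f ∈ F ↔ ¬ Γ.IsUp f := fun f ↦ by simp [F]
  obtain ⟨R, hRA, -, -, hRV, hRl⟩ := exists_reduction_of_isTwoCut hA hr
    (rotGraph_isRGraph hD hr hΓ) (rotGraph_isConnected hD) h F (Γ.cutSet D hD 0 k)
    (Γ.cutEdge 0 k false) (Γ.cutEdge 0 k true) (fun f ↦ .orig 0 k (Γ.ends f false))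
    (fun f ↦ .orig 0 k (Γ.ends f true)) (fun f hf ↦ isTwoCut_cutSet hD 0 k ((hF f).1 hf))
    (fun f _ f' _ hff ↦ disjoint_cutSet hD 0 k hff)
    (fun f _ f' _ ↦ orig_notMem_cutSet hD 0 k f' _)
    (fun f _ f' _ ↦ orig_notMem_cutSet hD 0 k f' _)
  simp only [hF] at hRV hRl
  have hRV' : ∀ x, x ∈ V(R) ↔ ∃ z, .orig 0 k z = x := by
    intro x
    rw [hRV]
    constructor
    · rintro ⟨h1, h2⟩
      exact (forall_notMem_cutSet_iff hD 0 k h1).1 h2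
    · rintro ⟨z, rfl⟩
      exact ⟨trivial, fun f _ ↦ orig_notMem_cutSet hD 0 k f z⟩
  -- The label of `f` in the reduced graph: a chosen edge keeps its own, and a restored edge
  -- inherits that of the cut edge at its `false` end.
  let ε : E → Edg.{v} E r := fun f ↦ if Γ.IsUp f then .tree 0 k f else Γ.cutEdge 0 k false f
  have hε : Function.Injective ε := by
    intro f f' hff
    simp only [ε, cutEdge] at hff
    split_ifs at hff <;> simp_all
  have hinj : Function.Injective (Vtx.orig.{u} (V := V) (E := E) (0 : ZMod r) k) := fun _ _ h ↦ by
    simpa using h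
  have hl : ∀ e z w, R.IsLink e (.orig 0 k z) (.orig 0 k w) ↔
      ∃ f, e = ε f ∧ Γ.graph.IsLink f z w := by
    intro e z w
    have hs : ∀ f, s((.orig 0 k z : Vtx.{u} V E r), .orig 0 k w) =
        s(.orig 0 k (Γ.ends f false), .orig 0 k (Γ.ends f true)) ↔ Γ.graph.IsLink f z w := by
      intro f
      change _ ↔ s(z, w) = s(_, _)
      simp only [Sym2.eq_iff, Vtx.orig.injEq, true_and]
    rw [hRl, rotGraph_isLink_orig]
    simp only [hs]
    constructor
    · rintro (⟨⟨f, h1, rfl, h2⟩, -⟩ | ⟨f, h1, rfl, h2⟩)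
      · exact ⟨f, by simp [ε, h1], h2⟩
      · exact ⟨f, by simp [ε, h1], h2⟩
    · rintro ⟨f, rfl, h2⟩
      by_cases h1 : Γ.IsUp f
      · exact .inl ⟨⟨f, h1, by simp [ε, h1], h2⟩, fun f' _ ↦ orig_notMem_cutSet hD 0 k f' z,
          fun f' _ ↦ orig_notMem_cutSet hD 0 k f' w⟩
      · exact .inr ⟨f, h1, by simp [ε, h1], h2⟩
  have hεE : ∀ f, ε f ∈ E(R) := fun f ↦ ((hl _ _ _).2 ⟨f, rfl, Γ.isLink_ends f⟩).edge_mem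
  refine ⟨R, hRA, ?_⟩
  have hbV : Function.Bijective fun z : V(Γ.graph) ↦
      (⟨.orig 0 k z, (hRV' _).2 ⟨z, rfl⟩⟩ : V(R)) := by
    constructor
    · intro z w hzw
      exact Subtype.ext (hinj (congrArg Subtype.val hzw))
    · rintro ⟨x, hx⟩
      obtain ⟨z, rfl⟩ := (hRV' x).1 hx
      exact ⟨⟨z, trivial⟩, rfl⟩
  have hbE : Function.Bijective fun f : E(Γ.graph) ↦ (⟨ε f, hεE f⟩ : E(R)) := by
    constructor
    · intro z w hzw
      exact Subtype.ext (hε (congrArg Subtype.val hzw))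
    · rintro ⟨e, he⟩
      obtain ⟨x, y, hxy⟩ := exists_isLink_of_mem_edgeSet he
      obtain ⟨z, rfl⟩ := (hRV' x).1 hxy.left_mem
      obtain ⟨w, rfl⟩ := (hRV' y).1 hxy.right_mem
      obtain ⟨f, rfl, hf⟩ := (hl ..).1 hxy
      exact ⟨⟨f, hf.edge_mem⟩, rfl⟩
  refine ⟨Equiv.ofBijective _ hbV, Equiv.ofBijective _ hbE, fun f z w ↦ ?_⟩
  simp only [Equiv.ofBijective_apply]
  rw [hl]
  constructor
  · exact fun h ↦ ⟨f, rfl, h⟩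
  · rintro ⟨f', hff, h⟩
    rwa [hε hff]

end Layered

end Graph

/-! ### The equivalence. -/

theorem mainTheorem2 (r : ℕ) (hr : Odd r)
    (A : ∀ (α : Type u) (β : Type v), Graph α β → Prop)
    (hA : Graph.IsGraphProperty A) (hA' : Graph.PreservedByTwoCutReduction A r) :
    (∀ (α : Type u) (β : Type v) (G : Graph α β), G.IsRGraph r → G.IsConnected → A α β G) ↔
      (∀ (α : Type u) (β : Type v) (G : Graph α β), G.IsRotationRGraph r → G.Simple → A α β G) := by
  constructor
  · rintro h α β G ⟨hG, i, T, v, φ, hT, hT', -⟩ -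
    have hTc : T.IsConnected := hT'.isTree.2.1
    exact h α β G hG (hTc.mono hT)
  · intro h α β G hG hc
    obtain rfl | hr' : r = 1 ∨ 1 < r := by have := hr.pos; omega
    · obtain ⟨h1, h2⟩ := hG.isRotationRGraph_of_one hc
      exact h α β G h1 h2
    obtain ⟨n, m, Γ, hΓ, hiso⟩ := hG.exists_layered hr.pos hc
    obtain ⟨D, hD⟩ : ∃ D, ∀ z, Γ.level z ≤ D :=
      ⟨Finset.univ.sup Γ.level, fun z ↦ Finset.le_sup (Finset.mem_univ z)⟩
    have hrot := Graph.Layered.rotGraph_isRotationRGraph.{u, v} hD hr'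
      (Graph.Layered.rotGraph_isRGraph hD hr hΓ)
    -- The reduced graph `R` lives on the types of the rotation graph; invariance under isomorphism
    -- carries the property through `Γ` back to `G`.
    obtain ⟨R, hRA, hR⟩ := Graph.Layered.of_rotGraph hD hr hr' hΓ hA'
      (h _ _ _ hrot (Graph.Layered.rotGraph_simple hD))
    exact hA _ _ _ _ R G (hR.symm.trans hiso) hRA
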